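/- Consider cellular automata with state set $\{0,1\}$ and the single site seed $u_o$ (state $1$ at the origin, $0$ elsewhere), namely the following four: Rule 90 on $\mathbb Z$, $(S_{90}u)_i=u_{i-1}+u_{i+1}$; Rule 150 on $\mathbb Z$, $(S_{150}u)_i=u_{i-1}+u_i+u_{i+1}$; $T_0$ on $\mathbb Z^2$, $(T_0u)_{i,j}=u_{i,j+1}+u_{i-1,j}+u_{i+1,j}+u_{i,j-1}$; $T_{528}$ on $\mathbb Z^2$, $(T_{528}u)_{i,j}=u_{i,j+1}+u_{i-1,j}+u_{i,j}+u_{i+1,j}+u_{i,j-1}$ (all mod $2$). For such an automaton $T$ let $cum_T(n)$ be the total number of nonzero states in $T^0u_o,T^1u_o,\dots,T^nu_o$, with $cum_T(-1)=0$, and let $$f_T(x)=\lim_{k\to\infty}\frac{cum_T\left(\left(\sum_{i=1}^k x_i2^{k-i}\right)-1\right)}{cum_T(2^k-1)}\qquad\text{for } x=\sum_{i=1}^\infty \frac{x_i}{2^i}\in[0,1],\ x_i\in\{0,1\}.$$ For each of the four automata $T$, the limit exists for every binary expansion, is the same for all expansions of the same $x$, and defines a function $f_T:[0,1]\to[0,1]$.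 With * $\alpha=\frac13$, $q(s)=2^s$ for $S_{90}$, * $\alpha=\frac{\sqrt5-1}4$, $q(s)=\frac{(-1)^{s+1}+2^{s+2}}3$ for $S_{150}$, * $\alpha=\frac15$, $q(s)=4^s$ for $T_0$, * $\alpha=\frac{\sqrt2-1}2$, $q(s)=\frac{17+7\sqrt{17}}{34}\left(\frac{3+\sqrt{17}}2\right)^s+\frac{17-7\sqrt{17}}{34}\left(\frac{3-\sqrt{17}}2\right)^s$ for $T_{528}$, the following hold: $0<\alpha<\frac12$; $q(s)$ is a positive integer for every integer $s\ge0$; * (a) $q(0)=1$; * (b) $q(s_1)q(s_2-1)<q(s_1+s_2)\le q(s_1)q(s_2)$ for all integers $s_1,s_2>0$; * (c) $q(s+1)\alpha^{s+2}<q(s)\alpha^{s+1}<\sum_{i=s+2}^\infty q(i-1)\alpha^i$ for all integers $s>0$; * (d) $\sum_{i=1}^\infty q(i-1)\alpha^i=1$; and for every binary expansion $x=\sum_{i\ge1}x_i/2^i\in[0,1]$, $$f_T(x)=\sum_{i=1}^\infty x_i\,r(x)_i\,\alpha^i,\qquad r(x)_i=\prod_{s=0}^{i-1}q(s)^{p_{i,s}},$$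 where $p_{i,s}$ is the number of clusters (maximal blocks) of exactly $s$ consecutive $1$s in the word $x_1x_2\cdots x_{i-1}$. Consequently each of $f_{S90}$, $f_{S150}$, $f_{T0}$, $f_{T528}$ is a singular function on $[0,1]$: it is strictly increasing, continuous, and differentiable with derivative zero at almost every point of $[0,1]$. -/

import Mathlib

open Filter Topology MeasureTheory

namespace CountingCA

/-! ### Cellular automata with states `{0, 1} = ZMod 2` -/

/-- Configurations on the sites `ι` (here `ι = ℤ` or `ι = ℤ × ℤ`). -/
abbrev Config (ι : Type) := ι → ZMod 2

/-- One-dimensional elementary cellular automaton with local rule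
`s (u_{i-1}) (u_i) (u_{i+1})`. -/
def eca1 (s : ZMod 2 → ZMod 2 → ZMod 2 → ZMod 2) (u : Config ℤ) : Config ℤ :=
  fun i => s (u (i - 1)) (u i) (u (i + 1))

/-- Two-dimensional elementary cellular automaton (von Neumann neighbourhood) with local rule
`t U L C R D`, where `U = u_{i,j+1}`, `L = u_{i-1,j}`, `C = u_{i,j}`, `R = u_{i+1,j}`,
`D = u_{i,j-1}`. -/
def eca2 (t : ZMod 2 → ZMod 2 → ZMod 2 → ZMod 2 → ZMod 2 → ZMod 2)
    (u : Config (ℤ × ℤ)) : Config (ℤ × ℤ) :=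
  fun p => t (u (p.1, p.2 + 1)) (u (p.1 - 1, p.2)) (u p) (u (p.1 + 1, p.2)) (u (p.1, p.2 - 1))

/-- Rule 90. -/
def S90 : Config ℤ → Config ℤ := eca1 fun l _ r => l + r

/-- Rule 150. -/
def S150 : Config ℤ → Config ℤ := eca1 fun l c r => l + c + r

/-- The linear rule `T₀`: sum modulo 2 of the four neighbours. -/
def T0 : Config (ℤ × ℤ) → Config (ℤ × ℤ) := eca2 fun u l _ r d => u + l + r + d

/-- The linear rule `T₅₂₈`: sum modulo 2 of the site and its four neighbours. -/
def T528 : Config (ℤ × ℤ) → Config (ℤ × ℤ) := eca2 fun u l c r d => u + l + c + r + d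

/-- The single site seed: state `1` at the origin and `0` elsewhere. -/
def seed (ι : Type) [DecidableEq ι] [Zero ι] : Config ι := Pi.single 0 1

/-- `num T n`: the number of nonzero states in `T^n u_o`. -/
noncomputable def num {ι : Type} [DecidableEq ι] [Zero ι] (T : Config ι → Config ι) (n : ℕ) : ℕ :=
  Set.ncard {i : ι | (T^[n] (seed ι)) i ≠ 0}

/-- `cumBelow T n` is the cumulative count `cum_T (n - 1)` over the time steps `0, …, n - 1`
(so `cumBelow T 0 = cum_T (-1) = 0`). -/
noncomputable def cumBelow {ι : Type} [DecidableEq ι] [Zero ι] (T : Config ι → Config ι)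
    (n : ℕ) : ℕ :=
  ∑ m ∈ Finset.range n, num T m

/-! ### The normalized cumulative-count function

A binary expansion `0.x₁x₂x₃…` is a sequence `x : ℕ → Fin 2`, with `x i` the digit `x_{i+1}`;
its value is `Real.ofDigits x = ∑ x i / 2 ^ (i + 1)`. -/

/-- The quotient `cum_T ((∑_{i=1}^k x_i 2^{k-i}) - 1) / cum_T (2^k - 1)`. -/
noncomputable def ratio {ι : Type} [DecidableEq ι] [Zero ι] (T : Config ι → Config ι)
    (x : ℕ → Fin 2) (k : ℕ) : ℝ :=
  (cumBelow T (∑ i ∈ Finset.range k, (x i : ℕ) * 2 ^ (k - 1 - i)) : ℝ) / (cumBelow T (2 ^ k) : ℝ)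

/-- A binary expansion of `x ∈ [0, 1]`; for `x = 1` it is `0.111…`. -/
noncomputable def expansion (x : ℝ) : ℕ → Fin 2 :=
  if x < 1 then Real.digits x 2 else fun _ => 1

/-- The function `f_T` on `[0, 1]`, as a limit of the quotients along a binary expansion. -/
noncomputable def normalizedCount {ι : Type} [DecidableEq ι] [Zero ι] (T : Config ι → Config ι)
    (x : ℝ) : ℝ :=
  limUnder atTop (ratio T (expansion x))

/-- `f_T` is a well-defined map `[0, 1] → [0, 1]`: along every binary expansion of every point
of `[0, 1]`, the quotients converge to the value of `f_T` at that point. -/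
def IsWellDefined {ι : Type} [DecidableEq ι] [Zero ι] (T : Config ι → Config ι) : Prop :=
  (∀ x : ℕ → Fin 2, Tendsto (ratio T x) atTop (𝓝 (normalizedCount T (Real.ofDigits x)))) ∧
  Set.MapsTo (normalizedCount T) (Set.Icc 0 1) (Set.Icc 0 1)

/-! ### The sufficient condition for singularity -/

/-- The number of clusters (maximal blocks) of exactly `s` consecutive `1`s in the word
`x 0, …, x (n - 1)`. (The value for `s = 0` never matters, since `q 0 = 1` below.) -/
def clusterCount (x : ℕ → Fin 2) (n s : ℕ) : ℕ :=
  ((Finset.range (n + 1)).filter fun a =>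
    a + s ≤ n ∧ (∀ j < s, x (a + j) = 1) ∧
      (a = 0 ∨ x (a - 1) = 0) ∧ (a + s = n ∨ x (a + s) = 0)).card

/-- `weight q x n = ∏ₛ q(s) ^ p_s`, with `p_s` the number of clusters of `s` consecutive `1`s
among the first `n` digits; so `r(x)_i = weight q x (i - 1)`. -/
def weight (q : ℕ → ℕ) (x : ℕ → Fin 2) (n : ℕ) : ℕ :=
  ∏ s ∈ Finset.range (n + 1), q s ^ clusterCount x n s

/-- The hypotheses of the singularity criterion on the parameter `α` and the function `q`. -/
structure SingularityConditions (α : ℝ) (q : ℕ → ℕ) : Prop where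
  alpha_pos : 0 < α
  alpha_lt_half : α < 1 / 2
  q_pos : ∀ s, 0 < q s
  cond_a : q 0 = 1
  cond_b : ∀ s₁ s₂ : ℕ, 0 < s₁ → 0 < s₂ →
    q s₁ * q (s₂ - 1) < q (s₁ + s₂) ∧ q (s₁ + s₂) ≤ q s₁ * q s₂
  cond_c : ∀ s : ℕ, 0 < s →
    (q (s + 1) : ℝ) * α ^ (s + 2) < (q s : ℝ) * α ^ (s + 1) ∧
      (q s : ℝ) * α ^ (s + 1) < ∑' j : ℕ, (q (s + 1 + j) : ℝ) * α ^ (s + 2 + j)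
  cond_d : HasSum (fun j : ℕ => (q j : ℝ) * α ^ (j + 1)) 1

/-- `f` satisfies all hypotheses of the singularity criterion with parameter `α` and with the
positive integer valued function `q` whose values are `w s`: the conditions on `α` and `q` hold,
and `f(x) = ∑_{i ≥ 1} x_i r(x)_i α^i` for every binary expansion of every `x ∈ [0, 1]`. -/
def SatisfiesSingularityHypotheses (f : ℝ → ℝ) (α : ℝ) (w : ℕ → ℝ) : Prop :=
  ∃ q : ℕ → ℕ, (∀ s, (q s : ℝ) = w s) ∧ SingularityConditions α q ∧
    ∀ x : ℕ → Fin 2,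
      HasSum (fun i : ℕ => ((x i : ℕ) : ℝ) * (weight q x i : ℝ) * α ^ (i + 1))
        (f (Real.ofDigits x))

/-- `f` is a singular function on `[0, 1]`: strictly increasing, continuous, and differentiable
with derivative zero almost everywhere. -/
def IsSingularFunction (f : ℝ → ℝ) : Prop :=
  StrictMonoOn f (Set.Icc 0 1) ∧ ContinuousOn f (Set.Icc 0 1) ∧
    ∀ᵐ x ∂(volume.restrict (Set.Icc (0 : ℝ) 1)), HasDerivWithinAt f 0 (Set.Icc 0 1) x

end CountingCA

/-!
Each of the four rules is multiplication by a Laurent polynomial `p` over `ZMod 2`, with exponents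
of size at most `1`, so `num T n` is the number of nonzero coefficients of `p ^ n`. Three facts
about these numbers carry everything (`ReplicatingCount`):

* since `p ^ (2 ^ k)` is `p` dilated by `2 ^ k`, a `0` between two binary words makes the
  corresponding powers of `p` non-overlapping, so that
  `num (2 ^ (k + 1) * n + m) = num n * num m` for `m < 2 ^ k` (`supportCard_pow_concat`);
* the number of nonzero coefficients is submultiplicative;
* splitting the sites into residue classes modulo `2` gives
  `num (4 n + 3) = b * num (2 n + 1) + c * num n`, where `(b, c)` is `(2, 0)`, `(1, 2)`, `(4, 0)`
  and `(3, 2)` for Rule 90, Rule 150, `T₀` and `T₅₂₈`; moreover `num 1 = b + c`.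

By the first fact, `num` at a binary word is the product of `q s = num (2 ^ s - 1)` over its
clusters of ones (`weight_eq`), and the cumulative count decomposes along the ones of the word
(`csum_prefixNat`). The cumulative counts `A k` up to time `2 ^ k - 1` satisfy
`A (k + 2) = (1 + b) * A (k + 1) + 2 * c * A k`, hence `A k * α ^ k` converges to a positive limit,
where `α` is the positive root of `(1 + b) * α + 2 * c * α ^ 2 = 1`. A single count `num n` with
`n < 2 ^ k` is `O((b + c / b) ^ k)`, which is of smaller order because `(b + c / b) * α < 1`.
Dominated convergence turns the finite decomposition into the series for `f_T`, and the limit does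
not depend on the binary expansion since it is insensitive to bounded changes of the time.

The conditions on `q` follow from its linear recursion and submultiplicativity. Finally, `f_T` is
a limit of rescalings of the monotone cumulative count, and its increments over dyadic intervals of
length `2 ^ (-m)` are `O(((b + c / b) * α) ^ m)`; the increments over left halves of dyadic
intervals are exactly `num n * α ^ m > 0`. This gives continuity and strict monotonicity. A monotone
function is differentiable almost everywhere, and at a point `t < 1` the derivative must be `0`:
the binary expansion of `t` has infinitely many zeros, and each of them yields a dyadic interval
around `t` whose left half carries the fraction `α ≠ 1 / 2` of the increment
(`derivative_eq_zero`).
-/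

namespace CountingCA

/-! ### Replicating counts -/

/-- The arithmetic shared by the counting sequences `n ↦ num T n` of the four automata: binary
words separated by a `0` do not interact, counts are submultiplicative, and appending a `1` to a
word that already ends in `1` obeys a two-term linear recursion. -/
structure ReplicatingCount (a : ℕ → ℕ) (b c : ℕ) : Prop where
  zero : a 0 = 1
  one : a 1 = b + c
  concat : ∀ n k m : ℕ, m < 2 ^ k → a (2 ^ (k + 1) * n + m) = a n * a m
  submul : ∀ m n : ℕ, a (m + n) ≤ a m * a n
  step : ∀ n : ℕ, a (4 * n + 3) = b * a (2 * n + 1) + c * a n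

/-- The conditions on the coefficients `b`, `c` of the recursion and on the reciprocal `α` of the
growth rate of the cumulative count. The equation `char_eq` is the characteristic equation of the
recursion of the cumulative counts up to the times `2 ^ k - 1`, and `slope` says that single counts
grow more slowly than these. -/
structure AdmissibleRate (b c : ℕ) (α : ℝ) : Prop where
  alpha_pos : 0 < α
  alpha_lt_half : α < 1 / 2
  one_le_b : 1 ≤ b
  two_le : 2 ≤ b + c
  char_eq : (1 + b) * α + 2 * c * α ^ 2 = 1
  slope : ((b : ℝ) ^ 2 + c) * α < b

/-- The cumulative count of `a` over the times `0, …, n - 1`; for `a = num T` it is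
`cumBelow T` by definition. -/
def csum (a : ℕ → ℕ) (n : ℕ) : ℕ := ∑ m ∈ Finset.range n, a m

/-- An upper bound, up to a constant factor, for the exponential growth rate of the single counts in
the number of binary digits of the time. -/
noncomputable def growth (b c : ℕ) : ℝ := b + c / b

namespace AdmissibleRate

variable {b c : ℕ} {α : ℝ}

lemma b_pos (hα : AdmissibleRate b c α) : (0 : ℝ) < b := by
  exact_mod_cast hα.one_le_b

lemma one_le_growth (hα : AdmissibleRate b c α) : 1 ≤ growth b c := by
  have h1 : (1 : ℝ) ≤ b := by exact_mod_cast hα.one_le_b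
  have h2 : (0 : ℝ) ≤ (c : ℝ) / b := by positivity
  unfold growth
  linarith

lemma b_mul_growth (hα : AdmissibleRate b c α) : (b : ℝ) * growth b c = b ^ 2 + c := by
  have := hα.b_pos
  unfold growth
  field_simp

lemma growth_mul_alpha_lt_one (hα : AdmissibleRate b c α) : growth b c * α < 1 := by
  have h := hα.slope
  rw [← hα.b_mul_growth, mul_assoc] at h
  exact (mul_lt_iff_lt_one_right hα.b_pos).1 h

lemma growth_mul_alpha_nonneg (hα : AdmissibleRate b c α) : 0 ≤ growth b c * α :=
  mul_nonneg (by linarith [hα.one_le_growth]) hα.alpha_pos.le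

lemma growth_sq (hα : AdmissibleRate b c α) :
    (b : ℝ) * growth b c + c ≤ growth b c ^ 2 ∧ (b + c : ℝ) ≤ growth b c ^ 2 := by
  have h1 : (1 : ℝ) ≤ b := by exact_mod_cast hα.one_le_b
  have h3 : (0 : ℝ) ≤ (c : ℝ) := by positivity
  have h4 : (0 : ℝ) ≤ (c : ℝ) / b := by positivity
  have h5 : (b : ℝ) * (c / b) = c := by field_simp
  unfold growth
  constructor <;> nlinarith

end AdmissibleRate

namespace ReplicatingCount

variable {a : ℕ → ℕ} {b c : ℕ} {α : ℝ}

lemma two_pow_mul (ha : ReplicatingCount a b c) (k n : ℕ) : a (2 ^ k * n) = a n := by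
  cases k with
  | zero => simp
  | succ k => simpa [ha.zero] using ha.concat n k 0 (by positivity)

lemma two_mul (ha : ReplicatingCount a b c) (n : ℕ) : a (2 * n) = a n := by
  simpa using ha.two_pow_mul 1 n

lemma four_mul_add_one (ha : ReplicatingCount a b c) (n : ℕ) :
    a (4 * n + 1) = (b + c) * a n := by
  have := ha.concat n 1 1 (by norm_num)
  rw [ha.one] at this
  simpa [mul_comm (a n)] using this

lemma pos (ha : ReplicatingCount a b c) (hα : AdmissibleRate b c α) (n : ℕ) : 0 < a n := by
  induction n using Nat.strong_induction_on with
  | _ n ih =>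
    have hb := hα.one_le_b
    obtain ⟨m, hm | hm | hm⟩ : ∃ m, n = 2 * m ∨ n = 4 * m + 1 ∨ n = 4 * m + 3 := by
      rcases Nat.even_or_odd' n with ⟨k, h | h⟩
      · exact ⟨k, Or.inl h⟩
      · exact ⟨k / 2, by omega⟩
    · rcases Nat.eq_zero_or_pos m with rfl | h0
      · simp [hm, ha.zero]
      · rw [hm, ha.two_mul]
        exact ih m (by omega)
    · rw [hm, ha.four_mul_add_one]
      exact Nat.mul_pos (by omega) (ih m (by omega))
    · rw [hm, ha.step]
      have := Nat.mul_pos hb (ih (2 * m + 1) (by omega))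
      omega

/-- Counts at times with `k` binary digits grow at most like `growth b c ^ k`, which is strictly
slower than the cumulative count. -/
lemma le_growth_pow (ha : ReplicatingCount a b c) (hα : AdmissibleRate b c α) (k : ℕ) :
    ∀ n < 2 ^ k, (a n : ℝ) ≤ b * growth b c ^ k := by
  have h1 : (1 : ℝ) ≤ b := by exact_mod_cast hα.one_le_b
  have hg := hα.one_le_growth
  obtain ⟨hs1, hs2⟩ := hα.growth_sq
  induction k using Nat.twoStepInduction with
  | zero =>
    intro n hn
    obtain rfl : n = 0 := by simpa using hn
    simpa [ha.zero] using h1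
  | one =>
    intro n hn
    rw [pow_one, hα.b_mul_growth]
    have h3 : (0 : ℝ) ≤ (c : ℝ) := by positivity
    obtain rfl | rfl : n = 0 ∨ n = 1 := by omega
    · rw [ha.zero]
      push_cast
      nlinarith
    · rw [ha.one]
      push_cast
      nlinarith
  | more k ih0 ih1 =>
    intro n hn
    have hp : (0 : ℝ) ≤ growth b c ^ k := by positivity
    obtain ⟨m, hm | hm | hm⟩ : ∃ m, n = 2 * m ∨ n = 4 * m + 1 ∨ n = 4 * m + 3 := by
      rcases Nat.even_or_odd' n with ⟨k, h | h⟩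
      · exact ⟨k, Or.inl h⟩
      · exact ⟨k / 2, by omega⟩
    · have := ih1 m (by rw [pow_succ] at hn ⊢; omega)
      rw [hm, ha.two_mul]
      refine this.trans (mul_le_mul_of_nonneg_left ?_ (by linarith))
      exact pow_le_pow_right₀ hg (by omega)
    · have := ih0 m (by rw [pow_succ, pow_succ] at hn; omega)
      rw [hm, ha.four_mul_add_one]
      push_cast
      calc (b + c : ℝ) * a m ≤ growth b c ^ 2 * (b * growth b c ^ k) := by gcongr
        _ = _ := by ring
    · have e0 := ih0 m (by rw [pow_succ, pow_succ] at hn; omega)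
      have e1 := ih1 (2 * m + 1) (by rw [pow_succ, pow_succ] at *; omega)
      rw [hm, ha.step]
      push_cast
      calc (b : ℝ) * a (2 * m + 1) + c * a m
          ≤ b * (b * growth b c ^ (k + 1)) + c * (b * growth b c ^ k) := by gcongr
        _ = (b * growth b c + c) * (b * growth b c ^ k) := by ring
        _ ≤ growth b c ^ 2 * (b * growth b c ^ k) := by gcongr
        _ = _ := by ring

/-! ### The cumulative count -/

lemma csum_add (a : ℕ → ℕ) (m n : ℕ) :
    csum a (m + n) = csum a m + ∑ r ∈ Finset.range n, a (m + r) :=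
  Finset.sum_range_add _ _ _

lemma csum_mono (a : ℕ → ℕ) : Monotone (csum a) :=
  fun _ _ h => Finset.sum_le_sum_of_subset (Finset.range_mono h)

/-- The times whose binary word starts with the word of `n` followed by a `0`. -/
lemma csum_block (ha : ReplicatingCount a b c) (n k : ℕ) :
    csum a (2 ^ (k + 1) * n + 2 ^ k) = csum a (2 ^ (k + 1) * n) + a n * csum a (2 ^ k) := by
  rw [csum_add, csum.eq_def a (2 ^ k), Finset.mul_sum]
  congr 1
  exact Finset.sum_congr rfl fun r hr => ha.concat n k r (Finset.mem_range.1 hr)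

lemma csum_block_le (ha : ReplicatingCount a b c) (n k : ℕ) :
    csum a (2 ^ k * n + 2 ^ k) ≤ csum a (2 ^ k * n) + a n * csum a (2 ^ k) := by
  rw [csum_add, csum.eq_def a (2 ^ k), Finset.mul_sum]
  gcongr with r hr
  simpa [ha.two_pow_mul] using ha.submul (2 ^ k * n) r

/-- The last digits `00`, `01`, `10`, `11` contribute `num n`, `(b + c) num n`, `num (2 n + 1)` and
`b num (2 n + 1) + c num n`. -/
lemma csum_four_mul (ha : ReplicatingCount a b c) (n : ℕ) :
    csum a (4 * n) = (1 + b) * csum a (2 * n) + 2 * c * csum a n := by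
  induction n with
  | zero => simp [csum]
  | succ n ih =>
    have e1 : csum a (4 * (n + 1)) =
        csum a (4 * n) + a (4 * n) + a (4 * n + 1) + a (4 * n + 2) + a (4 * n + 3) := by
      simp [csum, mul_add, Finset.sum_range_succ]
    have e2 : csum a (2 * (n + 1)) = csum a (2 * n) + a (2 * n) + a (2 * n + 1) := by
      simp [csum, mul_add, Finset.sum_range_succ]
    have e3 : csum a (n + 1) = csum a n + a n := Finset.sum_range_succ _ _
    have f1 : a (4 * n) = a n := by simpa using ha.two_pow_mul 2 n
    have f2 : a (4 * n + 2) = a (2 * n + 1) := by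
      rw [← ha.two_mul (2 * n + 1)]
      ring_nf
    rw [e1, e2, e3, ih, f1, f2, ha.four_mul_add_one, ha.step, ha.two_mul]
    ring

/-- The normalized cumulative count `cum (2 ^ k - 1) α ^ k`. -/
noncomputable def scaledCum (a : ℕ → ℕ) (α : ℝ) (k : ℕ) : ℝ := csum a (2 ^ k) * α ^ k

/-- `cum (2 ^ k - 1)` grows exactly like `α ^ (-k)`: the first-order combination
`scaledCum (k + 1) + 2 c α² scaledCum k` does not depend on `k`, and `2 c α² < 1`. -/
lemma exists_tendsto_scaledCum (ha : ReplicatingCount a b c) (hα : AdmissibleRate b c α) :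
    ∃ L : ℝ, 0 < L ∧ Tendsto (scaledCum a α) atTop (𝓝 L) := by
  have hpos := hα.alpha_pos
  have hchar := hα.char_eq
  set ρ : ℝ := 2 * c * α ^ 2 with hρ
  have hρ0 : 0 ≤ ρ := by positivity
  have hρ1 : ρ < 1 := by
    have : 0 < (1 + b : ℝ) * α := by positivity
    linarith
  -- The equation for `α` factors the recursion into the roots `α⁻¹` and `-2 c α`.
  have hinv : ∀ k, scaledCum a α (k + 1) + ρ * scaledCum a α k =
      scaledCum a α 1 + ρ * scaledCum a α 0 := by
    intro k
    induction k with
    | zero => rfl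
    | succ k ih =>
      rw [← ih]
      have h := ha.csum_four_mul (2 ^ k)
      have e1 : 4 * 2 ^ k = 2 ^ (k + 1 + 1) := by ring
      have e2 : 2 * 2 ^ k = 2 ^ (k + 1) := by ring
      rw [e1, e2] at h
      have hR : (csum a (2 ^ (k + 1 + 1)) : ℝ) =
          (1 + b) * csum a (2 ^ (k + 1)) + 2 * c * csum a (2 ^ k) := by exact_mod_cast h
      simp only [scaledCum, hR]
      linear_combination ((csum a (2 ^ (k + 1)) : ℝ) * α ^ (k + 1)) * hchar +
        ((csum a (2 ^ k) : ℝ) * α ^ k) * hρ - ((csum a (2 ^ k) : ℝ) * α ^ k) * hρ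
  set J := scaledCum a α 1 + ρ * scaledCum a α 0 with hJ
  have hJ0 : 0 < J := by
    have e0 : scaledCum a α 0 = 1 := by simp [scaledCum, csum, ha.zero]
    have e1 : scaledCum a α 1 = (1 + b + c) * α := by
      simp [scaledCum, csum, Finset.sum_range_succ, ha.zero, ha.one, add_assoc]
    rw [hJ, e0, e1]
    positivity
  refine ⟨J / (1 + ρ), by positivity, ?_⟩
  have hclosed : ∀ k, scaledCum a α k =
      J / (1 + ρ) + (-ρ) ^ k * (scaledCum a α 0 - J / (1 + ρ)) := by
    intro k
    induction k with
    | zero => ring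
    | succ k ih =>
      have h1 : (1 + ρ) ≠ 0 := by positivity
      have h2 : J / (1 + ρ) * (1 + ρ) = J := by field_simp
      rw [pow_succ]
      linear_combination hinv k - ρ * ih - h2
  have hz : Tendsto (fun k : ℕ => (-ρ) ^ k) atTop (𝓝 0) :=
    tendsto_pow_atTop_nhds_zero_of_abs_lt_one (by rw [abs_neg, abs_of_nonneg hρ0]; exact hρ1)
  have := (hz.mul_const (scaledCum a α 0 - J / (1 + ρ))).const_add (J / (1 + ρ))
  simp only [zero_mul, add_zero] at this
  exact this.congr fun k => (hclosed k).symm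

lemma csum_two_pow_pos (ha : ReplicatingCount a b c) (k : ℕ) : 0 < csum a (2 ^ k) := by
  have : csum a 1 = 1 := by simp [csum, ha.zero]
  have h := csum_mono a (Nat.one_le_two_pow (n := k))
  omega

lemma scaledCum_pos (ha : ReplicatingCount a b c) (hα : AdmissibleRate b c α) (k : ℕ) :
    0 < scaledCum a α k := by
  have := ha.csum_two_pow_pos k
  have := hα.alpha_pos
  unfold scaledCum
  positivity

lemma csum_div_csum (hα : AdmissibleRate b c α) (a : ℕ → ℕ) (k i : ℕ) :
    (csum a (2 ^ k) : ℝ) / csum a (2 ^ (k + i)) =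
      scaledCum a α k / scaledCum a α (k + i) * α ^ i := by
  have := hα.alpha_pos.ne'
  unfold scaledCum
  rw [pow_add α]
  field_simp

lemma tendsto_csum_div_csum (ha : ReplicatingCount a b c) (hα : AdmissibleRate b c α) (i : ℕ) :
    Tendsto (fun k => (csum a (2 ^ k) : ℝ) / csum a (2 ^ (k + i))) atTop (𝓝 (α ^ i)) := by
  obtain ⟨L, hL, hlim⟩ := ha.exists_tendsto_scaledCum hα
  have h := ((hlim.div ((tendsto_add_atTop_iff_nat i).2 hlim) hL.ne').mul_const (α ^ i))
  rw [div_self hL.ne', one_mul] at h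
  exact h.congr fun k => (csum_div_csum hα a k i).symm

lemma exists_csum_div_csum_le (ha : ReplicatingCount a b c) (hα : AdmissibleRate b c α) :
    ∃ K : ℝ, ∀ k i, (csum a (2 ^ k) : ℝ) / csum a (2 ^ (k + i)) ≤ K * α ^ i := by
  obtain ⟨L, hL, hlim⟩ := ha.exists_tendsto_scaledCum hα
  obtain ⟨M, hM⟩ := hlim.bddAbove_range
  obtain ⟨N, hN⟩ := (hlim.inv₀ hL.ne').bddAbove_range
  refine ⟨M * N, fun k i => ?_⟩
  have h1 : scaledCum a α k ≤ M := hM ⟨k, rfl⟩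
  have h2 : (scaledCum a α (k + i))⁻¹ ≤ N := hN ⟨k + i, rfl⟩
  have p1 := ha.scaledCum_pos hα k
  have p2 := ha.scaledCum_pos hα (k + i)
  have := hα.alpha_pos
  rw [csum_div_csum hα, div_eq_mul_inv]
  gcongr
  exact p1.le.trans h1

/-- A single time step is negligible against the cumulative count. -/
lemma tendsto_growth_pow_div_csum (ha : ReplicatingCount a b c) (hα : AdmissibleRate b c α) :
    Tendsto (fun k => growth b c ^ k / (csum a (2 ^ k) : ℝ)) atTop (𝓝 0) := by
  obtain ⟨L, hL, hlim⟩ := ha.exists_tendsto_scaledCum hα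
  have h := (tendsto_pow_atTop_nhds_zero_of_lt_one hα.growth_mul_alpha_nonneg
    hα.growth_mul_alpha_lt_one).div hlim hL.ne'
  rw [zero_div] at h
  refine h.congr fun k => ?_
  have := hα.alpha_pos.ne'
  have := ha.csum_two_pow_pos k
  simp only [Pi.div_apply, scaledCum, mul_pow]
  field_simp

end ReplicatingCount

/-! ### Binary words -/

/-- The natural number with binary digits `x 0, …, x (k - 1)`, most significant digit first. -/
def prefixNat (x : ℕ → Fin 2) (k : ℕ) : ℕ := ∑ i ∈ Finset.range k, (x i : ℕ) * 2 ^ (k - 1 - i)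

lemma prefixNat_succ (x : ℕ → Fin 2) (k : ℕ) :
    prefixNat x (k + 1) = 2 * prefixNat x k + x k := by
  unfold prefixNat
  rw [Finset.sum_range_succ, Finset.mul_sum]
  congr 1
  · refine Finset.sum_congr rfl fun i hi => ?_
    have := Finset.mem_range.1 hi
    rw [show k + 1 - 1 - i = k - 1 - i + 1 by omega, pow_succ]
    ring
  · simp

lemma prefixNat_lt (x : ℕ → Fin 2) (k : ℕ) : prefixNat x k < 2 ^ k := by
  induction k with
  | zero => simp [prefixNat]
  | succ k ih =>
    have := (x k).isLt
    rw [prefixNat_succ, pow_succ]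
    omega

lemma two_pow_mul_ofDigits (x : ℕ → Fin 2) (k : ℕ) :
    2 ^ k * Real.ofDigits x = prefixNat x k + Real.ofDigits fun i => x (i + k) := by
  have h : (2 : ℝ) ^ k * ∑ i ∈ Finset.range k, Real.ofDigitsTerm x i = prefixNat x k := by
    rw [prefixNat, Finset.mul_sum]
    push_cast
    refine Finset.sum_congr rfl fun i hi => ?_
    have := Finset.mem_range.1 hi
    obtain ⟨j, rfl⟩ : ∃ j, k = i + 1 + j := ⟨k - i - 1, by omega⟩
    rw [Real.ofDigitsTerm, show i + 1 + j - 1 - i = j by omega, pow_add _ (i + 1) j]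
    push_cast
    field_simp
  rw [Real.ofDigits_eq_sum_add_ofDigits x k, mul_add, h]
  push_cast
  field_simp

lemma abs_prefixNat_sub_le (x : ℕ → Fin 2) (k : ℕ) :
    |(prefixNat x k : ℝ) - 2 ^ k * Real.ofDigits x| ≤ 1 := by
  have h0 := Real.ofDigits_nonneg fun i => x (i + k)
  have h1 := Real.ofDigits_le_one fun i => x (i + k)
  rw [two_pow_mul_ofDigits, abs_le]
  constructor <;> linarith

lemma ofDigits_expansion {t : ℝ} (ht : t ∈ Set.Icc (0 : ℝ) 1) :
    Real.ofDigits (expansion t) = t := by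
  unfold expansion
  split_ifs with h
  · exact Real.ofDigits_digits (by norm_num) ⟨ht.1, h⟩
  · rw [le_antisymm ht.2 (not_lt.1 h)]
    exact Real.ofDigits_const_last_eq_one 1

/-! ### Clusters of ones -/

lemma clusterCount_eq_zero (x : ℕ → Fin 2) {n s : ℕ} (h : n < s) : clusterCount x n s = 0 := by
  rw [clusterCount, Finset.card_eq_zero, Finset.filter_eq_empty_iff]
  rintro a - ⟨h1, -⟩
  omega

/-- Appending a `0` and then a block of `t` ones creates exactly one new cluster, of size `t`. -/
lemma clusterCount_append (x : ℕ → Fin 2) (n t s : ℕ) (h0 : x n = 0)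
    (h1 : ∀ j < t, x (n + 1 + j) = 1) :
    clusterCount x (n + 1 + t) s = clusterCount x n s + if s = t then 1 else 0 := by
  have key : ∀ a, (a ∈ Finset.range (n + 1 + t + 1) ∧ a + s ≤ n + 1 + t ∧
        (∀ j < s, x (a + j) = 1) ∧ (a = 0 ∨ x (a - 1) = 0) ∧
        (a + s = n + 1 + t ∨ x (a + s) = 0)) ↔
      (a ∈ Finset.range (n + 1) ∧ a + s ≤ n ∧ (∀ j < s, x (a + j) = 1) ∧
        (a = 0 ∨ x (a - 1) = 0) ∧ (a + s = n ∨ x (a + s) = 0)) ∨ (a = n + 1 ∧ s = t) := by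
    intro a
    simp only [Finset.mem_range]
    constructor
    · rintro ⟨ha, hs, hj, hl, hr⟩
      rcases lt_trichotomy a (n + 1) with hlt | rfl | hgt
      · left
        have hsn : a + s ≤ n := by
          by_contra hcon
          have := hj (n - a) (by omega)
          rw [show a + (n - a) = n by omega, h0] at this
          exact absurd this (by decide)
        exact ⟨hlt, hsn, hj, hl, Or.inr (hr.resolve_left (by omega))⟩
      · right
        refine ⟨rfl, ?_⟩
        by_contra hne
        rcases hr with hr | hr
        · omega
        · rw [h1 s (by omega)] at hr
          exact absurd hr (by decide)
      · exfalso
        rcases hl with hl | hl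
        · omega
        · have := h1 (a - 1 - (n + 1)) (by omega)
          rw [show n + 1 + (a - 1 - (n + 1)) = a - 1 by omega, hl] at this
          exact absurd this (by decide)
    · rintro (⟨ha, hs, hj, hl, hr⟩ | ⟨rfl, rfl⟩)
      · refine ⟨by omega, by omega, hj, hl, Or.inr ?_⟩
        rcases hr with hr | hr
        · rw [hr, h0]
        · exact hr
      · exact ⟨by omega, le_rfl, h1, Or.inr (by simpa using h0), Or.inl rfl⟩
  have hset : (Finset.range (n + 1 + t + 1)).filter (fun a => a + s ≤ n + 1 + t ∧
        (∀ j < s, x (a + j) = 1) ∧ (a = 0 ∨ x (a - 1) = 0) ∧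
        (a + s = n + 1 + t ∨ x (a + s) = 0)) =
      (Finset.range (n + 1)).filter (fun a => a + s ≤ n ∧ (∀ j < s, x (a + j) = 1) ∧
        (a = 0 ∨ x (a - 1) = 0) ∧ (a + s = n ∨ x (a + s) = 0)) ∪
      (if s = t then {n + 1} else ∅) := by
    ext a
    rw [Finset.mem_filter, key a, Finset.mem_union, Finset.mem_filter]
    refine or_congr Iff.rfl ?_
    split_ifs with h <;> simp [h]
  rw [clusterCount, hset, Finset.card_union_of_disjoint]
  · rw [clusterCount]
    congr 1
    split_ifs <;> simp
  · rw [Finset.disjoint_left]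
    intro a ha hb
    have := Finset.mem_range.1 (Finset.mem_filter.1 ha).1
    split_ifs at hb
    · rw [Finset.mem_singleton] at hb
      omega
    · simp at hb

lemma clusterCount_ones (x : ℕ → Fin 2) (t s : ℕ) (h1 : ∀ j < t, x j = 1) :
    clusterCount x t s = if s = t then 1 else 0 := by
  have hset : (Finset.range (t + 1)).filter (fun a => a + s ≤ t ∧
        (∀ j < s, x (a + j) = 1) ∧ (a = 0 ∨ x (a - 1) = 0) ∧ (a + s = t ∨ x (a + s) = 0)) =
      if s = t then {0} else ∅ := by
    ext a
    simp only [Finset.mem_filter, Finset.mem_range]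
    constructor
    · rintro ⟨ha, hs, hj, hl, hr⟩
      have ha0 : a = 0 := by
        by_contra hne
        have := hl.resolve_left hne
        rw [h1 _ (by omega)] at this
        exact absurd this (by decide)
      subst ha0
      have hst : s = t := by
        by_contra hne
        have := hr.resolve_left (by omega)
        rw [h1 _ (by omega)] at this
        exact absurd this (by decide)
      simp [hst]
    · intro ha
      split_ifs at ha with h
      · obtain rfl := Finset.mem_singleton.1 ha
        subst h
        exact ⟨by omega, by omega, by simpa using h1, Or.inl rfl, Or.inl (by omega)⟩
      · simp at ha
  rw [clusterCount, hset]
  split_ifs <;> simp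

lemma weight_eq_prod (q : ℕ → ℕ) (x : ℕ → Fin 2) {n N : ℕ} (h : n ≤ N) :
    weight q x n = ∏ s ∈ Finset.range (N + 1), q s ^ clusterCount x n s := by
  refine Finset.prod_subset (Finset.range_mono (by omega)) fun s _ hs => ?_
  rw [clusterCount_eq_zero x (by simpa using hs), pow_zero]

lemma weight_append (q : ℕ → ℕ) (x : ℕ → Fin 2) (n t : ℕ) (h0 : x n = 0)
    (h1 : ∀ j < t, x (n + 1 + j) = 1) :
    weight q x (n + 1 + t) = weight q x n * q t := by
  rw [weight_eq_prod q x (show n ≤ n + 1 + t by omega), weight]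
  simp only [clusterCount_append x n t _ h0 h1, pow_add, Finset.prod_mul_distrib]
  congr 1
  rw [Finset.prod_eq_single t]
  · simp
  · intro s _ hs
    simp [hs]
  · intro ht
    exact absurd (Finset.mem_range.2 (by omega)) ht

lemma weight_ones (q : ℕ → ℕ) (x : ℕ → Fin 2) (t : ℕ) (h1 : ∀ j < t, x j = 1) :
    weight q x t = q t := by
  rw [weight]
  simp only [clusterCount_ones x t _ h1]
  rw [Finset.prod_eq_single t]
  · simp
  · intro s _ hs
    simp [hs]
  · intro ht
    exact absurd (Finset.mem_range.2 (by omega)) ht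

lemma prefixNat_append (x : ℕ → Fin 2) (n t : ℕ) (h0 : x n = 0)
    (h1 : ∀ j < t, x (n + 1 + j) = 1) :
    prefixNat x (n + 1 + t) = 2 ^ (t + 1) * prefixNat x n + (2 ^ t - 1) := by
  induction t with
  | zero => simp [prefixNat_succ, h0]
  | succ t ih =>
    have := Nat.one_le_two_pow (n := t)
    rw [← add_assoc, prefixNat_succ, ih fun j hj => h1 j (by omega), h1 t (by omega),
      pow_succ 2 (t + 1), pow_succ 2 t]
    simp only [Fin.val_one]
    rw [Nat.mul_add, ← mul_assoc, mul_comm 2 (2 ^ t * 2)]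
    omega

lemma prefixNat_ones (x : ℕ → Fin 2) (t : ℕ) (h1 : ∀ j < t, x j = 1) :
    prefixNat x t = 2 ^ t - 1 := by
  induction t with
  | zero => simp [prefixNat]
  | succ t ih =>
    have := Nat.one_le_two_pow (n := t)
    rw [prefixNat_succ, ih fun j hj => h1 j (by omega), h1 t (by omega), pow_succ]
    simp only [Fin.val_one]
    omega

lemma digit_eq_zero_or_one (i : Fin 2) : i = 0 ∨ i = 1 := by
  revert i
  decide

lemma eq_ones_or_append (x : ℕ → Fin 2) (n : ℕ) :
    (∀ j < n, x j = 1) ∨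
      ∃ m t, n = m + 1 + t ∧ x m = 0 ∧ ∀ j < t, x (m + 1 + j) = 1 := by
  induction n with
  | zero => simp
  | succ n ih =>
    rcases digit_eq_zero_or_one (x n) with h | h
    · exact Or.inr ⟨n, 0, by omega, h, by simp⟩
    · rcases ih with ih | ⟨m, t, rfl, hm, ht⟩
      · left
        intro j hj
        rcases Nat.lt_succ_iff_lt_or_eq.1 hj with hj | rfl
        · exact ih j hj
        · exact h
      · refine Or.inr ⟨m, t + 1, by omega, hm, fun j hj => ?_⟩
        rcases Nat.lt_succ_iff_lt_or_eq.1 hj with hj | rfl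
        · exact ht j hj
        · exact h

namespace ReplicatingCount

variable {a : ℕ → ℕ} {b c : ℕ} {α : ℝ}

/-- The count at the time with binary word `x 0, …, x (n - 1)` is the product of the counts of
its clusters of ones. -/
lemma weight_eq (ha : ReplicatingCount a b c) (x : ℕ → Fin 2) (n : ℕ) :
    weight (fun s => a (2 ^ s - 1)) x n = a (prefixNat x n) := by
  induction n using Nat.strong_induction_on with
  | _ n ih =>
    rcases eq_ones_or_append x n with h | ⟨m, t, rfl, hm, ht⟩
    · rw [weight_ones _ x n h, prefixNat_ones x n h]
    · rw [weight_append _ x m t hm ht, prefixNat_append x m t hm ht, ih m (by omega),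
        ha.concat _ _ _ (Nat.sub_lt (by positivity) one_pos)]

/-- The times below the number with binary word `x 0, …, x (n - 1)` followed by `r` zeros, grouped
by the first digit `x j = 1` that they replace by a `0`. -/
lemma csum_prefixNat (ha : ReplicatingCount a b c) (x : ℕ → Fin 2) (n : ℕ) :
    ∀ r, csum a (2 ^ r * prefixNat x n) =
      ∑ j ∈ Finset.range n, x j * a (prefixNat x j) * csum a (2 ^ (r + (n - 1 - j))) := by
  induction n with
  | zero => simp [prefixNat, csum]
  | succ n ih =>
    intro r
    rw [Finset.sum_range_succ]
    have h := ih (r + 1)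
    rw [Finset.sum_congr rfl (g := fun j => x j * a (prefixNat x j) *
      csum a (2 ^ (r + (n + 1 - 1 - j))))
      fun j hj => by
        have := Finset.mem_range.1 hj
        rw [show r + 1 + (n - 1 - j) = r + (n + 1 - 1 - j) by omega]] at h
    rw [← h, prefixNat_succ]
    rcases digit_eq_zero_or_one (x n) with h0 | h1
    · simp only [h0, Fin.val_zero]
      rw [pow_succ]
      ring_nf
    · simp only [h1, Fin.val_one, one_mul]
      rw [show 2 ^ r * (2 * prefixNat x n + 1) = 2 ^ (r + 1) * prefixNat x n + 2 ^ r by ring,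
        ha.csum_block]
      simp

lemma summable_bound (hα : AdmissibleRate b c α) (K : ℝ) :
    Summable fun j : ℕ => (b * growth b c ^ j) * (K * α ^ (j + 1)) := by
  have h := (summable_geometric_of_lt_one hα.growth_mul_alpha_nonneg
    hα.growth_mul_alpha_lt_one).mul_left (b * K * α)
  refine h.congr fun j => ?_
  rw [mul_pow]
  ring

/-- Along every digit sequence the quotients of cumulative counts converge, by dominated
convergence for series, to the series of digits. -/
lemma exists_hasSum_and_tendsto (ha : ReplicatingCount a b c) (hα : AdmissibleRate b c α)
    (x : ℕ → Fin 2) :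
    ∃ F : ℝ, HasSum (fun j : ℕ => ((x j : ℕ) : ℝ) * a (prefixNat x j) * α ^ (j + 1)) F ∧
      Tendsto (fun k => (csum a (prefixNat x k) : ℝ) / csum a (2 ^ k)) atTop (𝓝 F) := by
  have hpos := hα.alpha_pos
  have hdig : ∀ j, ((x j : ℕ) : ℝ) ≤ 1 := fun j => by
    have := (x j).isLt
    exact_mod_cast (by omega : (x j : ℕ) ≤ 1)
  have hcoef : ∀ j, ((x j : ℕ) : ℝ) * a (prefixNat x j) ≤ b * growth b c ^ j := fun j =>
    (mul_le_of_le_one_left (by positivity) (hdig j)).trans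
      (ha.le_growth_pow hα j _ (prefixNat_lt x j))
  have hsum : Summable fun j : ℕ => ((x j : ℕ) : ℝ) * a (prefixNat x j) * α ^ (j + 1) := by
    refine Summable.of_nonneg_of_le (fun j => by positivity) (fun j => ?_) (summable_bound hα 1)
    rw [one_mul]
    exact mul_le_mul_of_nonneg_right (hcoef j) (by positivity)
  refine ⟨_, hsum.hasSum, ?_⟩
  obtain ⟨K, hK⟩ := ha.exists_csum_div_csum_le hα
  have hf : ∀ k, ∑' j, (if j < k then ((x j : ℕ) : ℝ) * a (prefixNat x j) *
      ((csum a (2 ^ (k - 1 - j)) : ℝ) / csum a (2 ^ k)) else 0) =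
      (csum a (prefixNat x k) : ℝ) / csum a (2 ^ k) := by
    intro k
    rw [tsum_eq_sum (s := Finset.range k) fun j hj => if_neg (by simpa using hj)]
    have h := ha.csum_prefixNat x k 0
    rw [pow_zero, one_mul] at h
    rw [h]
    push_cast
    rw [Finset.sum_div]
    refine Finset.sum_congr rfl fun j hj => ?_
    rw [if_pos (Finset.mem_range.1 hj), zero_add]
    ring
  refine Tendsto.congr hf (tendsto_tsum_of_dominated_convergence (summable_bound hα K)
    (fun j => ?_) (Eventually.of_forall fun k j => ?_))
  · refine Tendsto.congr' ?_ (((tendsto_add_atTop_iff_nat (j + 1)).1 ?_ : Tendsto (fun k =>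
      ((x j : ℕ) : ℝ) * a (prefixNat x j) * ((csum a (2 ^ (k - 1 - j)) : ℝ) / csum a (2 ^ k)))
      atTop _))
    · filter_upwards [eventually_gt_atTop j] with k hk
      rw [if_pos hk]
    · refine ((ha.tendsto_csum_div_csum hα (j + 1)).const_mul _).congr fun k => ?_
      rw [show k + (j + 1) - 1 - j = k by omega]
  · split_ifs with h
    · have := hK (k - 1 - j) (j + 1)
      rw [show k - 1 - j + (j + 1) = k by omega] at this
      rw [Real.norm_of_nonneg (by positivity)]
      exact mul_le_mul (hcoef j) this (by positivity) (hcoef j |>.trans' (by positivity))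
    · have h0 : (0 : ℝ) ≤ K * α ^ (j + 1) := le_trans (by positivity) (hK 0 (j + 1))
      have := hα.one_le_growth
      rw [norm_zero]
      positivity

end ReplicatingCount

namespace ReplicatingCount

/-! ### The limit function on dyadic intervals -/

lemma csum_le_add_two {a : ℕ → ℕ} {b c : ℕ} {α : ℝ} (ha : ReplicatingCount a b c)
    (hα : AdmissibleRate b c α) {m n k : ℕ} (hmn : n ≤ m + 2) (hm : m < 2 ^ k + 2) :
    (csum a n : ℝ) ≤ csum a m + 2 * b * growth b c ^ (k + 2) := by
  have h : csum a n ≤ csum a m + a m + a (m + 1) := by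
    refine (csum_mono a hmn).trans (le_of_eq ?_)
    rw [csum, Finset.sum_range_succ, Finset.sum_range_succ, csum]
  have hp : 2 ^ (k + 2) = 2 ^ k * 4 := pow_add 2 k 2
  have hk := Nat.one_le_two_pow (n := k)
  have h1 := ha.le_growth_pow hα (k + 2) m (by omega)
  have h2 := ha.le_growth_pow hα (k + 2) (m + 1) (by omega)
  have h' : (csum a n : ℝ) ≤ csum a m + a m + a (m + 1) := by exact_mod_cast h
  linarith

variable {ι : Type} [DecidableEq ι] [Zero ι] {T : Config ι → Config ι} {b c : ℕ} {α : ℝ}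

/-- The limit defining `normalizedCount T t` may be computed along any sequence of times within
distance `1` of `2 ^ k * t`. -/
lemma tendsto_of_abs_sub_le (ha : ReplicatingCount (num T) b c) (hα : AdmissibleRate b c α)
    {t : ℝ} (ht : t ∈ Set.Icc (0 : ℝ) 1) {N : ℕ → ℕ}
    (hN : ∀ᶠ k in atTop, |(N k : ℝ) - 2 ^ k * t| ≤ 1) :
    Tendsto (fun k => (csum (num T) (N k) : ℝ) / csum (num T) (2 ^ k)) atTop
      (𝓝 (normalizedCount T t)) := by
  obtain ⟨F, -, hF⟩ := ha.exists_hasSum_and_tendsto hα (expansion t)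
  have hval : normalizedCount T t = F := Tendsto.limUnder_eq hF
  rw [hval]
  have hz := (ha.tendsto_growth_pow_div_csum hα).const_mul (2 * b * growth b c ^ 2)
  rw [mul_zero] at hz
  have hlow := hF.sub hz
  have hupp := hF.add hz
  rw [sub_zero] at hlow
  rw [add_zero] at hupp
  have hg := hα.one_le_growth
  have hnear : ∀ᶠ k in atTop, N k ≤ prefixNat (expansion t) k + 2 ∧
      prefixNat (expansion t) k ≤ N k + 2 ∧ N k < 2 ^ k + 2 := by
    filter_upwards [hN] with k hk
    have hp := abs_prefixNat_sub_le (expansion t) k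
    rw [ofDigits_expansion ht] at hp
    rw [abs_le] at hk hp
    have ht1 : (2 : ℝ) ^ k * t ≤ 2 ^ k := mul_le_of_le_one_right (by positivity) ht.2
    refine ⟨?_, ?_, ?_⟩
    · exact_mod_cast (by linarith : (N k : ℝ) ≤ prefixNat (expansion t) k + 2)
    · exact_mod_cast (by linarith : (prefixNat (expansion t) k : ℝ) ≤ N k + 2)
    · exact_mod_cast (by linarith : (N k : ℝ) < 2 ^ k + 2)
  refine tendsto_of_tendsto_of_tendsto_of_le_of_le' hlow hupp ?_ ?_
  · filter_upwards [hnear] with k ⟨h1, h2, h3⟩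
    have hpos : (0 : ℝ) < csum (num T) (2 ^ k) := by exact_mod_cast ha.csum_two_pow_pos k
    have := csum_le_add_two ha hα h2 (k := k) (by omega)
    rw [mul_div_assoc', ← sub_div]
    refine div_le_div_of_nonneg_right ?_ hpos.le
    rw [pow_add] at this
    linarith
  · filter_upwards [hnear] with k ⟨h1, h2, h3⟩
    have hpos : (0 : ℝ) < csum (num T) (2 ^ k) := by exact_mod_cast ha.csum_two_pow_pos k
    have := csum_le_add_two ha hα h1 (k := k) (by have := prefixNat_lt (expansion t) k; omega)
    rw [mul_div_assoc', ← add_div]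
    refine div_le_div_of_nonneg_right ?_ hpos.le
    rw [pow_add] at this
    linarith

lemma tendsto_ratio (ha : ReplicatingCount (num T) b c) (hα : AdmissibleRate b c α)
    (x : ℕ → Fin 2) :
    Tendsto (ratio T x) atTop (𝓝 (normalizedCount T (Real.ofDigits x))) :=
  ha.tendsto_of_abs_sub_le hα ⟨Real.ofDigits_nonneg x, Real.ofDigits_le_one x⟩
    (Eventually.of_forall (abs_prefixNat_sub_le x))

lemma tendsto_floor (ha : ReplicatingCount (num T) b c) (hα : AdmissibleRate b c α)
    {t : ℝ} (ht : t ∈ Set.Icc (0 : ℝ) 1) :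
    Tendsto (fun k => (csum (num T) ⌊2 ^ k * t⌋₊ : ℝ) / csum (num T) (2 ^ k)) atTop
      (𝓝 (normalizedCount T t)) := by
  refine ha.tendsto_of_abs_sub_le hα ht (Eventually.of_forall fun k => ?_)
  have h0 : 0 ≤ 2 ^ k * t := mul_nonneg (by positivity) ht.1
  have h1 := Nat.floor_le h0
  have h2 := Nat.lt_floor_add_one (2 ^ k * t)
  rw [abs_le]
  constructor <;> linarith

lemma tendsto_dyadic (ha : ReplicatingCount (num T) b c) (hα : AdmissibleRate b c α)
    {j m : ℕ} (hj : j ≤ 2 ^ m) :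
    Tendsto (fun k => (csum (num T) (2 ^ k * j) : ℝ) / csum (num T) (2 ^ (k + m))) atTop
      (𝓝 (normalizedCount T (j / 2 ^ m))) := by
  have hj' : (j : ℝ) ≤ 2 ^ m := by exact_mod_cast hj
  have h := ha.tendsto_of_abs_sub_le hα (t := j / 2 ^ m) (N := fun k => 2 ^ (k - m) * j)
    ⟨by positivity, (div_le_one (by positivity)).2 hj'⟩ (by
      filter_upwards [eventually_ge_atTop m] with k hk
      obtain ⟨r, rfl⟩ := Nat.exists_eq_add_of_le' hk
      rw [Nat.add_sub_cancel, pow_add]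
      push_cast
      rw [show (2 : ℝ) ^ r * 2 ^ m * (j / 2 ^ m) = 2 ^ r * j by field_simp]
      simp)
  refine ((tendsto_add_atTop_iff_nat m).2 h).congr fun k => ?_
  rw [Nat.add_sub_cancel]

lemma isWellDefined (ha : ReplicatingCount (num T) b c) (hα : AdmissibleRate b c α) :
    IsWellDefined T := by
  refine ⟨ha.tendsto_ratio hα, fun t ht => ?_⟩
  have h := ha.tendsto_ratio hα (expansion t)
  rw [ofDigits_expansion ht] at h
  refine isClosed_Icc.mem_of_tendsto h (Eventually.of_forall fun k => ⟨?_, ?_⟩)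
  · unfold ratio
    positivity
  · have hle : csum (num T) (prefixNat (expansion t) k) ≤ csum (num T) (2 ^ k) :=
      csum_mono _ (prefixNat_lt _ k).le
    refine div_le_one_of_le₀ ?_ (by positivity)
    exact_mod_cast hle

lemma hasSum_normalizedCount (ha : ReplicatingCount (num T) b c) (hα : AdmissibleRate b c α)
    (x : ℕ → Fin 2) :
    HasSum (fun i : ℕ => ((x i : ℕ) : ℝ) * (weight (fun s => num T (2 ^ s - 1)) x i : ℝ) *
      α ^ (i + 1)) (normalizedCount T (Real.ofDigits x)) := by
  obtain ⟨F, hF, hlim⟩ := ha.exists_hasSum_and_tendsto hα x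
  rw [tendsto_nhds_unique (ha.tendsto_ratio hα x) hlim]
  simpa only [ha.weight_eq] using hF

/-- On the left half of a dyadic interval, the increment is exact: the binary word of the left
endpoint is followed by a `0`. -/
lemma normalizedCount_left_half (ha : ReplicatingCount (num T) b c) (hα : AdmissibleRate b c α)
    {n m : ℕ} (hn : 2 * n + 1 ≤ 2 ^ m) :
    normalizedCount T ((2 * n + 1 : ℕ) / 2 ^ m) - normalizedCount T ((2 * n : ℕ) / 2 ^ m) =
      num T n * α ^ m := by
  have h1 := ha.tendsto_dyadic hα hn
  have h2 := ha.tendsto_dyadic hα (show 2 * n ≤ 2 ^ m by omega)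
  have h3 := (ha.tendsto_csum_div_csum hα m).const_mul (num T n : ℝ)
  refine tendsto_nhds_unique (h1.sub h2) (h3.congr fun k => ?_)
  have h := ha.csum_block n k
  rw [show 2 ^ (k + 1) * n + 2 ^ k = 2 ^ k * (2 * n + 1) by ring,
    show 2 ^ (k + 1) * n = 2 ^ k * (2 * n) by ring] at h
  rw [h]
  push_cast
  ring

lemma normalizedCount_succ_sub_le (ha : ReplicatingCount (num T) b c)
    (hα : AdmissibleRate b c α) {n m : ℕ} (hn : n < 2 ^ m) :
    normalizedCount T ((n + 1 : ℕ) / 2 ^ m) - normalizedCount T (n / 2 ^ m) ≤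
      b * (growth b c * α) ^ m := by
  have h1 := ha.tendsto_dyadic hα (show n + 1 ≤ 2 ^ m from hn)
  have h2 := ha.tendsto_dyadic hα hn.le
  have h3 := (ha.tendsto_csum_div_csum hα m).const_mul (num T n : ℝ)
  have hle : normalizedCount T ((n + 1 : ℕ) / 2 ^ m) - normalizedCount T (n / 2 ^ m) ≤
      num T n * α ^ m := by
    refine le_of_tendsto_of_tendsto' (h1.sub h2) h3 fun k => ?_
    have h := ha.csum_block_le n k
    rw [show 2 ^ k * n + 2 ^ k = 2 ^ k * (n + 1) by ring] at h
    have h' : (csum (num T) (2 ^ k * (n + 1)) : ℝ) ≤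
        csum (num T) (2 ^ k * n) + num T n * csum (num T) (2 ^ k) := by exact_mod_cast h
    rw [← sub_div, mul_div_assoc']
    refine div_le_div_of_nonneg_right ?_ (by positivity)
    linarith
  refine hle.trans ?_
  rw [mul_pow, ← mul_assoc]
  have := hα.alpha_pos
  gcongr
  exact ha.le_growth_pow hα m n hn

/-! ### Singularity of the limit function -/

lemma monotoneOn_normalizedCount (ha : ReplicatingCount (num T) b c)
    (hα : AdmissibleRate b c α) : MonotoneOn (normalizedCount T) (Set.Icc 0 1) := by
  intro s hs t ht hst
  refine le_of_tendsto_of_tendsto' (ha.tendsto_floor hα hs) (ha.tendsto_floor hα ht) fun k => ?_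
  have h : csum (num T) ⌊2 ^ k * s⌋₊ ≤ csum (num T) ⌊2 ^ k * t⌋₊ :=
    csum_mono _ (Nat.floor_mono (by gcongr))
  gcongr

lemma strictMonoOn_normalizedCount (ha : ReplicatingCount (num T) b c)
    (hα : AdmissibleRate b c α) : StrictMonoOn (normalizedCount T) (Set.Icc 0 1) := by
  intro s hs t ht hst
  obtain ⟨m, hm⟩ := pow_unbounded_of_one_lt (2 / (t - s)) (one_lt_two : (1 : ℝ) < 2)
  have hm' : 2 < 2 ^ m * (t - s) := (div_lt_iff₀ (by linarith)).1 hm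
  set n := ⌊2 ^ m * s⌋₊ + 1 with hn
  have hp : (0 : ℝ) < 2 ^ m := by positivity
  have h1 := Nat.floor_le (show 0 ≤ 2 ^ m * s from mul_nonneg hp.le hs.1)
  have h2 := Nat.lt_floor_add_one (2 ^ m * s)
  have hnR : (n : ℝ) = ⌊2 ^ m * s⌋₊ + 1 := by rw [hn]; push_cast; rfl
  have hsn : s ≤ (2 * n : ℕ) / 2 ^ (m + 1) := by
    rw [le_div_iff₀ (by positivity), pow_succ]
    push_cast
    linarith
  have hnt : ((2 * n + 1 : ℕ) : ℝ) / 2 ^ (m + 1) ≤ t := by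
    rw [div_le_iff₀ (by positivity), pow_succ]
    push_cast
    linarith
  have hle : 2 * n + 1 ≤ 2 ^ (m + 1) := by
    have := (div_le_one (by positivity)).1 (hnt.trans ht.2)
    exact_mod_cast this
  have hmid : ((2 * n : ℕ) : ℝ) / 2 ^ (m + 1) ≤ ((2 * n + 1 : ℕ) : ℝ) / 2 ^ (m + 1) := by
    gcongr
    omega
  have hinc := ha.normalizedCount_left_half hα hle
  have hpos : (0 : ℝ) < num T n * α ^ (m + 1) := by
    have := ha.pos hα n
    have := hα.alpha_pos
    positivity
  have e1 := ha.monotoneOn_normalizedCount hα hs ⟨by positivity, by linarith [ht.2]⟩ hsn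
  have e2 := ha.monotoneOn_normalizedCount hα ⟨by positivity, by linarith [ht.2]⟩ ht hnt
  linarith

lemma normalizedCount_add_sub_le (ha : ReplicatingCount (num T) b c)
    (hα : AdmissibleRate b c α) (m n : ℕ) : ∀ d : ℕ, n + d ≤ 2 ^ m →
    normalizedCount T ((n + d : ℕ) / 2 ^ m) - normalizedCount T (n / 2 ^ m) ≤
      d * (b * (growth b c * α) ^ m) := by
  intro d
  induction d with
  | zero => simp
  | succ d ih =>
    intro hd
    have h1 := ih (by omega)
    have h2 := ha.normalizedCount_succ_sub_le hα (n := n + d) (m := m) (by omega)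
    rw [← add_assoc]
    push_cast at *
    linarith

lemma normalizedCount_sub_le (ha : ReplicatingCount (num T) b c) (hα : AdmissibleRate b c α)
    {m : ℕ} {s t : ℝ} (hs : s ∈ Set.Icc (0 : ℝ) 1) (ht : t ∈ Set.Icc (0 : ℝ) 1)
    (hst : 2 ^ m * (t - s) ≤ 1) :
    normalizedCount T t - normalizedCount T s ≤ 2 * (b * (growth b c * α) ^ m) := by
  have hp : (0 : ℝ) < 2 ^ m := by positivity
  set n := ⌊2 ^ m * s⌋₊ with hn
  have h1 := Nat.floor_le (show 0 ≤ 2 ^ m * s from mul_nonneg hp.le hs.1)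
  have h2 := Nat.lt_floor_add_one (2 ^ m * s)
  rw [← hn] at h1 h2
  have hnm : n ≤ 2 ^ m := by
    have h3 : (2 : ℝ) ^ m * s ≤ 2 ^ m := mul_le_of_le_one_right hp.le hs.2
    exact_mod_cast h1.trans h3
  -- The right end of the covering dyadic interval is truncated at `1`.
  obtain ⟨d, hd2, hdm, htd⟩ : ∃ d ≤ 2, n + d ≤ 2 ^ m ∧ t ≤ ((n + d : ℕ) : ℝ) / 2 ^ m := by
    rcases le_total (n + 2) (2 ^ m) with h | h
    · refine ⟨2, le_rfl, h, ?_⟩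
      rw [le_div_iff₀ hp]
      push_cast
      linarith
    · refine ⟨2 ^ m - n, by omega, by omega, ?_⟩
      rw [Nat.add_sub_cancel' hnm]
      push_cast
      rw [div_self hp.ne']
      exact ht.2
  have hdR : ((n + d : ℕ) : ℝ) ≤ 2 ^ m := by exact_mod_cast hdm
  have hnR : (n : ℝ) ≤ 2 ^ m := by exact_mod_cast hnm
  have hns : (n : ℝ) / 2 ^ m ≤ s := by
    rw [div_le_iff₀ hp]
    linarith
  have e1 := ha.monotoneOn_normalizedCount hα ⟨by positivity, (div_le_one hp).2 hnR⟩ hs hns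
  have e2 := ha.monotoneOn_normalizedCount hα ht ⟨by positivity, (div_le_one hp).2 hdR⟩ htd
  have e3 := ha.normalizedCount_add_sub_le hα m n d hdm
  have e4 : (d : ℝ) * (b * (growth b c * α) ^ m) ≤ 2 * (b * (growth b c * α) ^ m) := by
    have := hα.growth_mul_alpha_nonneg
    gcongr
    exact_mod_cast hd2
  linarith

lemma continuousOn_normalizedCount (ha : ReplicatingCount (num T) b c)
    (hα : AdmissibleRate b c α) : ContinuousOn (normalizedCount T) (Set.Icc 0 1) := by
  rw [Metric.continuousOn_iff]
  intro s hs ε hε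
  have hz : Tendsto (fun m : ℕ => 2 * (b * (growth b c * α) ^ m)) atTop (𝓝 0) := by
    have := ((tendsto_pow_atTop_nhds_zero_of_lt_one hα.growth_mul_alpha_nonneg
      hα.growth_mul_alpha_lt_one).const_mul (b : ℝ)).const_mul 2
    simpa using this
  obtain ⟨m, hm⟩ := ((tendsto_order.1 hz).2 ε hε).exists
  have hp : (0 : ℝ) < 2 ^ m := by positivity
  refine ⟨(2 ^ m)⁻¹, by positivity, fun t ht hst => ?_⟩
  rw [Real.dist_eq] at hst ⊢
  have hle : 2 ^ m * |t - s| ≤ 1 := by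
    have := mul_le_mul_of_nonneg_left hst.le hp.le
    rwa [mul_inv_cancel₀ hp.ne'] at this
  have e1 := ha.normalizedCount_sub_le hα hs ht (m := m)
    ((mul_le_mul_of_nonneg_left (le_abs_self _) hp.le).trans hle)
  have e2 := ha.normalizedCount_sub_le hα ht hs (m := m)
    ((mul_le_mul_of_nonneg_left (by rw [abs_sub_comm]; exact le_abs_self _) hp.le).trans hle)
  rw [abs_lt]
  constructor <;> linarith

/-- Every point of `[0, 1)` lies, at arbitrarily fine levels, in the left half of its dyadic
interval: otherwise all its binary digits are eventually `1`. -/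
lemma exists_even_floor {t : ℝ} (ht : t ∈ Set.Ico (0 : ℝ) 1) (M : ℕ) :
    ∃ m ≥ M, ∃ n : ℕ, ⌊2 ^ m * t⌋₊ = 2 * n := by
  by_contra hcon
  push Not at hcon
  have hfl : ∀ r : ℕ, ⌊2 ^ (M + r) * t⌋₊ + 1 = 2 ^ r * (⌊2 ^ M * t⌋₊ + 1) := by
    intro r
    induction r with
    | zero => simp
    | succ r ih =>
      have h0 : 0 ≤ 2 ^ (M + r) * t := mul_nonneg (by positivity) ht.1
      have hdiv : ⌊2 ^ (M + (r + 1)) * t⌋₊ / 2 = ⌊2 ^ (M + r) * t⌋₊ := by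
        rw [← Nat.floor_div_natCast, ← add_assoc, pow_succ]
        congr 1
        push_cast
        ring
      have hodd := hcon (M + (r + 1)) (by omega)
      have := hodd (⌊2 ^ (M + (r + 1)) * t⌋₊ / 2)
      rw [pow_succ, mul_comm (2 ^ r) 2, mul_assoc, ← ih]
      omega
  have hgap : 0 < (⌊2 ^ M * t⌋₊ : ℝ) + 1 - 2 ^ M * t := by
    linarith [Nat.lt_floor_add_one ((2 : ℝ) ^ M * t)]
  obtain ⟨r, hr⟩ := pow_unbounded_of_one_lt
    (1 / ((⌊2 ^ M * t⌋₊ : ℝ) + 1 - 2 ^ M * t)) (one_lt_two : (1 : ℝ) < 2)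
  have h1 := (div_lt_iff₀ hgap).1 hr
  have h2 := Nat.floor_le (show 0 ≤ 2 ^ (M + r) * t from mul_nonneg (by positivity) ht.1)
  have h3 : (⌊2 ^ (M + r) * t⌋₊ : ℝ) + 1 = 2 ^ r * (⌊2 ^ M * t⌋₊ + 1) := by
    exact_mod_cast hfl r
  rw [pow_add] at h2 h3
  nlinarith

/-- At a point of `[0, 1)` the derivative can only be `0`: at arbitrarily fine levels the point
lies in a dyadic interval whose left half carries the fraction `α ≠ 1 / 2` of the increment,
while a nonzero derivative would force the fraction `1 / 2` in the limit. -/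
lemma derivative_eq_zero (ha : ReplicatingCount (num T) b c) (hα : AdmissibleRate b c α)
    {t D : ℝ} (ht : t ∈ Set.Ico (0 : ℝ) 1)
    (hD : HasDerivWithinAt (normalizedCount T) D (Set.Icc 0 1) t) : D = 0 := by
  by_contra hne
  have hhalf := hα.alpha_lt_half
  have hα0 := hα.alpha_pos
  set ε := |D| * (1 / 2 - α) / 4 with hε
  have hεpos : 0 < ε := by
    have := abs_pos.2 hne
    have : 0 < 1 / 2 - α := by linarith
    positivity
  have hlo := (hasDerivWithinAt_iff_isLittleO.1 hD).bound hεpos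
  rw [eventually_nhdsWithin_iff, Metric.eventually_nhds_iff] at hlo
  obtain ⟨δ, hδ, hlo⟩ := hlo
  obtain ⟨M, hM⟩ := exists_pow_lt_of_lt_one hδ (by norm_num : (1 / 2 : ℝ) < 1)
  obtain ⟨m, hmM, n, hn⟩ := exists_even_floor ht M
  have hp : (0 : ℝ) < 2 ^ m := by positivity
  set η : ℝ := (2 ^ m)⁻¹ with hη
  have hηpos : 0 < η := by positivity
  have hpη : 2 ^ m * η = 1 := mul_inv_cancel₀ hp.ne'
  have hηδ : η < δ := by
    refine lt_of_le_of_lt ?_ hM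
    rw [hη, ← inv_pow, one_div]
    exact pow_le_pow_of_le_one (by norm_num) (by norm_num) hmM
  have h1 := Nat.floor_le (show 0 ≤ 2 ^ m * t from mul_nonneg hp.le ht.1)
  have h2 := Nat.lt_floor_add_one (2 ^ m * t)
  rw [hn] at h1 h2
  push_cast at h1 h2
  have hle : 2 * n + 1 ≤ 2 ^ m := by
    have h3 : (2 * n : ℝ) < 2 ^ m := h1.trans_lt (mul_lt_of_lt_one_right hp ht.2)
    have h4 : 2 * n < 2 ^ m := by exact_mod_cast h3
    omega
  have hleR : (2 * n + 1 : ℝ) ≤ 2 ^ m := by exact_mod_cast hle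
  have hat : 2 * n * η ≤ t := by nlinarith
  have htb : t < (2 * n + 1) * η := by nlinarith
  have hb1 : (2 * n + 1) * η ≤ 1 := by nlinarith
  have ha0 : 0 ≤ 2 * n * η := by positivity
  -- The linear approximation at a point of the dyadic interval around `t`.
  have happ : ∀ y, 2 * n * η ≤ y → y ≤ (2 * n + 1) * η →
      |normalizedCount T y - normalizedCount T t - (y - t) * D| ≤ ε * η := by
    intro y hy1 hy2
    have hyt : |y - t| ≤ η := by
      rw [abs_le]
      constructor <;> linarith
    have h := hlo (y := y) (by rw [Real.dist_eq]; linarith) ⟨by linarith, by linarith⟩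
    rw [Real.norm_eq_abs, Real.norm_eq_abs, smul_eq_mul] at h
    exact h.trans (mul_le_mul_of_nonneg_left hyt hεpos.le)
  have ea := happ (2 * n * η) le_rfl (by linarith)
  have ec := happ ((4 * n + 1) * (η / 2)) (by linarith) (by linarith)
  have eb := happ ((2 * n + 1) * η) (by linarith) le_rfl
  have inc1 := ha.normalizedCount_left_half hα hle
  have inc2 := ha.normalizedCount_left_half hα (n := 2 * n) (m := m + 1)
    (by rw [pow_succ]; omega)
  rw [ha.two_mul, pow_succ α] at inc2
  have s1 : ((2 * n : ℕ) : ℝ) / 2 ^ m = 2 * n * η := by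
    rw [div_eq_mul_inv]
    push_cast
    rfl
  have s2 : ((2 * n + 1 : ℕ) : ℝ) / 2 ^ m = (2 * n + 1) * η := by
    rw [div_eq_mul_inv]
    push_cast
    rfl
  have s3 : ((2 * (2 * n) : ℕ) : ℝ) / 2 ^ (m + 1) = 2 * n * η := by
    rw [pow_succ, div_eq_mul_inv, mul_inv]
    push_cast
    ring
  have s4 : ((2 * (2 * n) + 1 : ℕ) : ℝ) / 2 ^ (m + 1) = (4 * n + 1) * (η / 2) := by
    rw [pow_succ, div_eq_mul_inv, mul_inv]
    push_cast
    ring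
  rw [s1, s2] at inc1
  rw [s3, s4] at inc2
  have key : η * (|D| * (1 / 2 - α)) ≤ 3 * (ε * η) := by
    have hsplit : η * (D * (1 / 2 - α)) =
        α * (normalizedCount T ((2 * n + 1) * η) - normalizedCount T t -
          ((2 * n + 1) * η - t) * D) +
        (1 - α) * (normalizedCount T (2 * n * η) - normalizedCount T t -
          (2 * n * η - t) * D) -
        (normalizedCount T ((4 * n + 1) * (η / 2)) - normalizedCount T t -
          ((4 * n + 1) * (η / 2) - t) * D) := by
      linear_combination inc2 - α * inc1
    have habs : η * (|D| * (1 / 2 - α)) = |η * (D * (1 / 2 - α))| := by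
      rw [abs_mul, abs_mul, abs_of_pos hηpos, abs_of_pos (by linarith : 0 < 1 / 2 - α)]
    rw [habs, hsplit, abs_le]
    rw [abs_le] at ea eb ec
    have hεη : 0 < ε * η := by positivity
    constructor <;> nlinarith
  have : η * (|D| * (1 / 2 - α)) = 4 * (ε * η) := by
    rw [hε]
    ring
  have hεη : 0 < ε * η := by positivity
  linarith

lemma isSingularFunction (ha : ReplicatingCount (num T) b c) (hα : AdmissibleRate b c α) :
    IsSingularFunction (normalizedCount T) := by
  refine ⟨ha.strictMonoOn_normalizedCount hα, ha.continuousOn_normalizedCount hα, ?_⟩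
  have hdiff := (ha.monotoneOn_normalizedCount hα).ae_differentiableWithinAt measurableSet_Icc
  have hne : ∀ᵐ t ∂(volume.restrict (Set.Icc (0 : ℝ) 1)), t ≠ 1 :=
    ae_restrict_of_ae (Measure.ae_ne volume 1)
  filter_upwards [hdiff, hne, ae_restrict_mem measurableSet_Icc] with t hd ht1 ht
  have h := hd.hasDerivWithinAt
  rwa [ha.derivative_eq_zero hα ⟨ht.1, lt_of_le_of_ne ht.2 ht1⟩ h] at h

end ReplicatingCount

/-! ### Additive automata as powers in a group algebra -/

section GroupAlgebra

variable {ι : Type} [AddCommGroup ι]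

instance charP_addMonoidAlgebra : CharP (AddMonoidAlgebra (ZMod 2) ι) 2 :=
  charP_of_injective_algebraMap (algebraMap (ZMod 2) (AddMonoidAlgebra (ZMod 2) ι)).injective 2

/-- The substitution of `x ^ (2 ^ k)` for `x` in Laurent polynomials over `ZMod 2`: it dilates the
configuration of coefficients by `2 ^ k`. -/
noncomputable def dilate (k : ℕ) :
    AddMonoidAlgebra (ZMod 2) ι →+* AddMonoidAlgebra (ZMod 2) ι :=
  AddMonoidAlgebra.mapDomainRingHom (ZMod 2) (nsmulAddMonoidHom (2 ^ k))

lemma pow_two_pow_eq_dilate (k : ℕ) (f : AddMonoidAlgebra (ZMod 2) ι) :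
    f ^ 2 ^ k = dilate k f := by
  have h : iterateFrobenius (AddMonoidAlgebra (ZMod 2) ι) 2 k = dilate k := by
    refine AddMonoidAlgebra.ringHom_ext (fun r => ?_) fun m => ?_
    · simp [iterateFrobenius_def, dilate, AddMonoidAlgebra.single_pow, ZMod.pow_card_pow]
    · simp [iterateFrobenius_def, dilate, AddMonoidAlgebra.single_pow]
  rw [← h, iterateFrobenius_def]

/-- The number of nonzero coefficients. -/
def supportCard (f : AddMonoidAlgebra (ZMod 2) ι) : ℕ := f.coeff.support.card

lemma supportCard_mul_le (f g : AddMonoidAlgebra (ZMod 2) ι) :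
    supportCard (f * g) ≤ supportCard f * supportCard g := by
  classical
  exact (Finset.card_le_card (AddMonoidAlgebra.support_coeff_mul_subset f g)).trans
    Finset.card_add_le

lemma supportCard_mul (f g : AddMonoidAlgebra (ZMod 2) ι)
    (h : ∀ a ∈ f.coeff.support, ∀ b ∈ g.coeff.support, ∀ a' ∈ f.coeff.support,
      ∀ b' ∈ g.coeff.support, a' + b' = a + b → a' = a ∧ b' = b) :
    supportCard (f * g) = supportCard f * supportCard g := by
  classical
  have himg : (f * g).coeff.support =
      (f.coeff.support ×ˢ g.coeff.support).image fun p => p.1 + p.2 := by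
    refine Finset.Subset.antisymm ?_ ?_
    · intro x hx
      obtain ⟨a, ha, b, hb, rfl⟩ :=
        Finset.mem_add.1 (AddMonoidAlgebra.support_coeff_mul_subset f g hx)
      exact Finset.mem_image.2 ⟨(a, b), Finset.mem_product.2 ⟨ha, hb⟩, rfl⟩
    · intro x hx
      obtain ⟨⟨a, b⟩, hab, rfl⟩ := Finset.mem_image.1 hx
      obtain ⟨ha, hb⟩ := Finset.mem_product.1 hab
      rw [Finsupp.mem_support_iff, AddMonoidAlgebra.coeff_mul_add_of_uniqueAdd
        fun a' b' ha' hb' he => h a ha b hb a' ha' b' hb' he]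
      exact mul_ne_zero (Finsupp.mem_support_iff.1 ha) (Finsupp.mem_support_iff.1 hb)
  unfold supportCard
  rw [himg, Finset.card_image_of_injOn, Finset.card_product]
  rintro ⟨a', b'⟩ hab' ⟨a, b⟩ hab he
  obtain ⟨ha, hb⟩ := Finset.mem_product.1 hab
  obtain ⟨ha', hb'⟩ := Finset.mem_product.1 hab'
  obtain ⟨h1, h2⟩ := h a ha b hb a' ha' b' hb' he
  exact Prod.ext h1 h2

variable {κ : Type} {π : κ → ι →+ ℤ}

lemma coord_le_of_mem_support_pow {p : AddMonoidAlgebra (ZMod 2) ι}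
    (hp : ∀ g ∈ p.coeff.support, ∀ i, |π i g| ≤ 1) (m : ℕ) :
    ∀ g ∈ (p ^ m).coeff.support, ∀ i, |π i g| ≤ m := by
  classical
  induction m with
  | zero =>
    intro g hg i
    rw [pow_zero, AddMonoidAlgebra.one_def, AddMonoidAlgebra.coeff_single] at hg
    obtain rfl := Finset.mem_singleton.1 (Finsupp.support_single_subset hg)
    simp
  | succ m ih =>
    intro g hg i
    rw [pow_succ] at hg
    obtain ⟨a, ha, b, hb, rfl⟩ :=
        Finset.mem_add.1 (AddMonoidAlgebra.support_coeff_mul_subset _ _ hg)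
    rw [map_add]
    push_cast
    exact (abs_add_le _ _).trans (add_le_add (ih a ha i) (hp b hb i))

lemma nsmul_two_pow_injective (hπ : ∀ g, (∀ i, π i g = 0) → g = 0) (k : ℕ) :
    Function.Injective fun g : ι => 2 ^ k • g := by
  intro g g' h
  refine sub_eq_zero.1 (hπ _ fun i => ?_)
  have h' := congrArg (π i) h
  simp only [map_nsmul, nsmul_eq_mul] at h'
  rw [map_sub, mul_left_cancel₀ (by positivity) h', sub_self]

lemma coeff_dilate_of_not (f : AddMonoidAlgebra (ZMod 2) ι) (k : ℕ) {g : ι}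
    (hg : ∀ g', 2 ^ k • g' ≠ g) : (dilate k f).coeff g = 0 := by
  refine Finsupp.mapDomain_of_notMem_range _ _ ?_
  rintro ⟨g', h⟩
  exact hg g' h

lemma coeff_dilate (hπ : ∀ g, (∀ i, π i g = 0) → g = 0) (f : AddMonoidAlgebra (ZMod 2) ι)
    (k : ℕ) (g : ι) : (dilate k f).coeff (2 ^ k • g) = f.coeff g :=
  Finsupp.mapDomain_apply (nsmul_two_pow_injective hπ k) _ _

lemma supportCard_dilate (hπ : ∀ g, (∀ i, π i g = 0) → g = 0)
    (f : AddMonoidAlgebra (ZMod 2) ι) (k : ℕ) : supportCard (dilate k f) = supportCard f := by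
  classical
  have h : (dilate k f).coeff.support = f.coeff.support.image fun g => 2 ^ k • g :=
    Finsupp.mapDomain_support_of_injective (nsmul_two_pow_injective hπ k) _
  rw [supportCard, h, Finset.card_image_of_injective _ (nsmul_two_pow_injective hπ k),
    supportCard]

/-- For `m < 2 ^ k`, the power `p ^ (2 ^ (k + 1) n + m)` is a superposition of translates of
`p ^ m`, one for each nonzero coefficient of `p ^ n`, and these translates are disjoint. -/
lemma supportCard_pow_concat (hπ : ∀ g, (∀ i, π i g = 0) → g = 0)
    {p : AddMonoidAlgebra (ZMod 2) ι} (hp : ∀ g ∈ p.coeff.support, ∀ i, |π i g| ≤ 1)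
    (n k m : ℕ) (hm : m < 2 ^ k) :
    supportCard (p ^ (2 ^ (k + 1) * n + m)) = supportCard (p ^ n) * supportCard (p ^ m) := by
  rw [pow_add, mul_comm (2 ^ (k + 1)), pow_mul, pow_two_pow_eq_dilate, supportCard_mul,
    supportCard_dilate hπ]
  intro a ha b hb a' ha' b' hb' he
  have hrange : ∀ a ∈ (dilate (k + 1) (p ^ n)).coeff.support, ∃ g, 2 ^ (k + 1) • g = a := by
    intro a ha
    by_contra hcon
    push Not at hcon
    exact Finsupp.mem_support_iff.1 ha (coeff_dilate_of_not _ _ hcon)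
  obtain ⟨g, rfl⟩ := hrange a ha
  obtain ⟨g', rfl⟩ := hrange a' ha'
  have hgg : g' = g := by
    refine sub_eq_zero.1 (hπ _ fun i => ?_)
    have h1 := coord_le_of_mem_support_pow hp m b hb i
    have h2 := coord_le_of_mem_support_pow hp m b' hb' i
    have h3 := congrArg (π i) he
    simp only [map_add, map_nsmul, nsmul_eq_mul] at h3
    push_cast at h3
    have hm' : (m : ℤ) < 2 ^ k := by exact_mod_cast hm
    rw [pow_succ] at h3
    rw [abs_le] at h1 h2
    have hlt : (2 : ℤ) ^ k * |π i g' - π i g| < 2 ^ k * 1 := by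
      have hpk : (0 : ℤ) < 2 ^ k := by positivity
      rw [← abs_of_pos hpk, ← abs_mul, abs_of_pos hpk, abs_lt]
      constructor <;> linarith
    rw [map_sub, ← Int.abs_lt_one_iff]
    exact lt_of_mul_lt_mul_left hlt (by positivity)
  subst hgg
  exact ⟨rfl, add_left_cancel he⟩

variable {T : Config ι → Config ι} {p : AddMonoidAlgebra (ZMod 2) ι}

lemma coeff_pow_two_mul_add_one
    (hT : ∀ f : AddMonoidAlgebra (ZMod 2) ι, T f.coeff = (p * f).coeff) (n : ℕ) :
    ((p ^ (2 * n + 1)).coeff : ι → ZMod 2) = T (dilate 1 (p ^ n)).coeff := by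
  rw [hT, ← pow_two_pow_eq_dilate, pow_one, ← pow_mul, ← pow_succ', mul_comm n]

variable [DecidableEq ι]

lemma iterate_seed (hT : ∀ f : AddMonoidAlgebra (ZMod 2) ι, T f.coeff = (p * f).coeff) (n : ℕ) :
    T^[n] (seed ι) = (p ^ n).coeff := by
  induction n with
  | zero =>
    rw [pow_zero, AddMonoidAlgebra.one_def, AddMonoidAlgebra.coeff_single]
    exact (Finsupp.single_eq_pi_single 0 1).symm
  | succ n ih => rw [Function.iterate_succ_apply', ih, hT, pow_succ']

lemma num_eq_supportCard
    (hT : ∀ f : AddMonoidAlgebra (ZMod 2) ι, T f.coeff = (p * f).coeff) (n : ℕ) :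
    num T n = supportCard (p ^ n) := by
  rw [num, iterate_seed hT, supportCard, ← Set.ncard_coe_finset]
  congr 1
  ext i
  simp

/-- The number of nonzero sites of a configuration, possibly infinite. -/
noncomputable def sites {σ : Type} (u : Config σ) : ℕ∞ := Set.encard {i | u i ≠ 0}

lemma sites_coeff_pow (hT : ∀ f : AddMonoidAlgebra (ZMod 2) ι, T f.coeff = (p * f).coeff)
    (n : ℕ) : sites (p ^ n).coeff = num T n := by
  rw [num_eq_supportCard hT, supportCard, ← Set.encard_coe_eq_coe_finsetCard, sites]
  congr 1
  ext i
  simp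

/-- An additive automaton with nearest-neighbour rule has a replicating count, provided that the
number of nonzero sites satisfies a linear recursion under "dilate by `2`, then apply `T`". -/
lemma replicatingCount_of_coeff (hπ : ∀ g, (∀ i, π i g = 0) → g = 0)
    (hp : ∀ g ∈ p.coeff.support, ∀ i, |π i g| ≤ 1)
    (hT : ∀ f : AddMonoidAlgebra (ZMod 2) ι, T f.coeff = (p * f).coeff) {b c : ℕ}
    (hone : supportCard p = b + c)
    (hstep : ∀ f g : AddMonoidAlgebra (ZMod 2) ι, g.coeff = T (dilate 1 f).coeff →
      sites (T (dilate 1 g).coeff) = b * sites g.coeff + c * sites f.coeff) :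
    ReplicatingCount (num T) b c where
  zero := by
    rw [num_eq_supportCard hT, pow_zero, supportCard, AddMonoidAlgebra.one_def,
      AddMonoidAlgebra.coeff_single, Finsupp.support_single _ one_ne_zero, Finset.card_singleton]
  one := by rw [num_eq_supportCard hT, pow_one, hone]
  concat n k m hm := by
    simp only [num_eq_supportCard hT]
    exact supportCard_pow_concat hπ hp n k m hm
  submul m n := by
    simp only [num_eq_supportCard hT, pow_add]
    exact supportCard_mul_le _ _
  step n := by
    have h := hstep (p ^ n) (p ^ (2 * n + 1)) (coeff_pow_two_mul_add_one hT n)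
    rw [← coeff_pow_two_mul_add_one hT, sites_coeff_pow hT, sites_coeff_pow hT,
      sites_coeff_pow hT, show 2 * (2 * n + 1) + 1 = 4 * n + 3 by ring] at h
    exact_mod_cast h

end GroupAlgebra

/-! ### Counting sites by residue classes -/

lemma sites_eq_add_of_parity (u : Config ℤ) :
    sites u = sites (fun i => u (2 * i)) + sites (fun i => u (2 * i + 1)) := by
  have i0 : Function.Injective fun i : ℤ => 2 * i := fun i j h => by simpa using h
  have i1 : Function.Injective fun i : ℤ => 2 * i + 1 := fun i j h => by simpa using h
  unfold sites
  rw [← i0.encard_image {i | u (2 * i) ≠ 0}, ← i1.encard_image {i | u (2 * i + 1) ≠ 0},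
    ← Set.encard_union_eq]
  · congr 1
    ext i
    simp only [Set.mem_ofPred_eq, Set.mem_union, Set.mem_image]
    constructor
    · intro h
      rcases Int.even_or_odd' i with ⟨j, rfl | rfl⟩
      · exact Or.inl ⟨j, h, rfl⟩
      · exact Or.inr ⟨j, h, rfl⟩
    · rintro (⟨j, h, rfl⟩ | ⟨j, h, rfl⟩) <;> exact h
  · rw [Set.disjoint_left]
    rintro _ ⟨i, -, rfl⟩ ⟨j, -, h⟩
    simp only at h
    omega

lemma sites_comp_add {ι : Type} [AddCommGroup ι] (u : Config ι) (g : ι) :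
    sites (fun i => u (i + g)) = sites u := by
  unfold sites
  rw [← (add_left_injective g).encard_image]
  congr 1
  ext i
  simp only [Set.mem_ofPred_eq, Set.mem_image]
  constructor
  · rintro ⟨j, h, rfl⟩
    exact h
  · intro h
    exact ⟨i - g, by simpa using h, by simp⟩

lemma sites_zero {σ : Type} : sites (fun _ : σ => (0 : ZMod 2)) = 0 := by
  simp [sites]

lemma sites_eq_add_of_parity_fst (u : Config (ℤ × ℤ)) :
    sites u = sites (fun p : ℤ × ℤ => u (2 * p.1, p.2)) +
      sites (fun p : ℤ × ℤ => u (2 * p.1 + 1, p.2)) := by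
  have i0 : Function.Injective fun p : ℤ × ℤ => (2 * p.1, p.2) := fun p q h => by
    simpa [Prod.ext_iff] using h
  have i1 : Function.Injective fun p : ℤ × ℤ => (2 * p.1 + 1, p.2) := fun p q h => by
    simpa [Prod.ext_iff] using h
  unfold sites
  rw [← i0.encard_image {p | u (2 * p.1, p.2) ≠ 0},
    ← i1.encard_image {p | u (2 * p.1 + 1, p.2) ≠ 0}, ← Set.encard_union_eq]
  · congr 1
    ext ⟨i, j⟩
    simp only [Set.mem_ofPred_eq, Set.mem_union, Set.mem_image]
    constructor
    · intro h
      rcases Int.even_or_odd' i with ⟨l, rfl | rfl⟩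
      · exact Or.inl ⟨(l, j), h, rfl⟩
      · exact Or.inr ⟨(l, j), h, rfl⟩
    · rintro (⟨l, h, he⟩ | ⟨l, h, he⟩) <;> rwa [he] at h
  · rw [Set.disjoint_left]
    rintro _ ⟨p, -, rfl⟩ ⟨q, -, h⟩
    have := congrArg Prod.fst h
    simp only at this
    omega

lemma sites_comp_swap (u : Config (ℤ × ℤ)) : sites (fun p : ℤ × ℤ => u p.swap) = sites u := by
  unfold sites
  rw [← Prod.swap_injective.encard_image]
  congr 1
  ext i
  simp only [Set.mem_ofPred_eq, Set.mem_image]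
  constructor
  · rintro ⟨j, h, rfl⟩
    exact h
  · intro h
    exact ⟨i.swap, by simpa using h, by simp⟩

lemma sites_eq_add_of_parity_snd (u : Config (ℤ × ℤ)) :
    sites u = sites (fun p : ℤ × ℤ => u (p.1, 2 * p.2)) +
      sites (fun p : ℤ × ℤ => u (p.1, 2 * p.2 + 1)) := by
  have h := sites_eq_add_of_parity_fst fun p : ℤ × ℤ => u p.swap
  rw [sites_comp_swap] at h
  rw [h, ← sites_comp_swap fun p : ℤ × ℤ => u (2 * p.1, p.2).swap,
    ← sites_comp_swap fun p : ℤ × ℤ => u (2 * p.1 + 1, p.2).swap]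
  rfl

lemma sites_eq_add_of_parities (u : Config (ℤ × ℤ)) :
    sites u = sites (fun p : ℤ × ℤ => u (2 * p.1, 2 * p.2)) +
      sites (fun p : ℤ × ℤ => u (2 * p.1, 2 * p.2 + 1)) +
      (sites (fun p : ℤ × ℤ => u (2 * p.1 + 1, 2 * p.2)) +
      sites (fun p : ℤ × ℤ => u (2 * p.1 + 1, 2 * p.2 + 1))) := by
  rw [sites_eq_add_of_parity_fst u, sites_eq_add_of_parity_snd fun p : ℤ × ℤ => u (2 * p.1, p.2),
    sites_eq_add_of_parity_snd fun p : ℤ × ℤ => u (2 * p.1 + 1, p.2)]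

lemma sites_comp_right (u : Config (ℤ × ℤ)) :
    sites (fun p : ℤ × ℤ => u (p.1 + 1, p.2)) = sites u := by
  rw [← sites_comp_add u (1, 0)]
  simp only [Prod.add_def, add_zero]

lemma sites_comp_up (u : Config (ℤ × ℤ)) :
    sites (fun p : ℤ × ℤ => u (p.1, p.2 + 1)) = sites u := by
  rw [← sites_comp_add u (0, 1)]
  simp only [Prod.add_def, add_zero]

lemma zmod_two_cancel (x y : ZMod 2) : x + (x + y) = y := by
  revert x y
  decide

lemma zmod_two_cancel' (x y : ZMod 2) : x + y + y = x := by
  revert x y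
  decide

/-! ### The automata on `ℤ` -/

lemma int_coord (g : ℤ) (h : ∀ i : Unit, (fun _ => AddMonoidHom.id ℤ) i g = 0) : g = 0 := h ()

lemma dilate_even (f : AddMonoidAlgebra (ZMod 2) ℤ) (i : ℤ) :
    (dilate 1 f).coeff (2 * i) = f.coeff i := by
  simpa using coeff_dilate int_coord f 1 i

lemma dilate_odd (f : AddMonoidAlgebra (ZMod 2) ℤ) (i : ℤ) :
    (dilate 1 f).coeff (2 * i + 1) = 0 :=
  coeff_dilate_of_not f 1 fun j h => by simp at h; omega

/-- Multiplication by `c + x + x⁻¹` on Laurent polynomials is Rule 90 for `c = 0` and Rule 150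
for `c = 1`. -/
noncomputable def poly1 (c : ZMod 2) : AddMonoidAlgebra (ZMod 2) ℤ :=
  AddMonoidAlgebra.single 1 1 + AddMonoidAlgebra.single 0 c + AddMonoidAlgebra.single (-1) 1

lemma coeff_poly1_mul (c : ZMod 2) (f : AddMonoidAlgebra (ZMod 2) ℤ) (i : ℤ) :
    (poly1 c * f).coeff i = f.coeff (i - 1) + c * f.coeff i + f.coeff (i + 1) := by
  simp only [poly1, add_mul, AddMonoidAlgebra.coeff_add, Finsupp.add_apply,
    AddMonoidAlgebra.coeff_single_mul_apply, one_mul]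
  rw [show -1 + i = i - 1 by ring, neg_zero, zero_add, neg_neg, add_comm 1 i]

lemma coeff_poly1 (c : ZMod 2) (i : ℤ) :
    (poly1 c).coeff i = if i = 0 then c else if i = 1 ∨ i = -1 then 1 else 0 := by
  simp only [poly1, AddMonoidAlgebra.coeff_add, Finsupp.add_apply,
    AddMonoidAlgebra.coeff_single, Finsupp.single_apply]
  split_ifs <;> first | omega | simp

lemma S90_coeff (f : AddMonoidAlgebra (ZMod 2) ℤ) : S90 f.coeff = (poly1 0 * f).coeff := by
  funext i
  rw [coeff_poly1_mul]
  simp [S90, eca1]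

lemma S150_coeff (f : AddMonoidAlgebra (ZMod 2) ℤ) : S150 f.coeff = (poly1 1 * f).coeff := by
  funext i
  rw [coeff_poly1_mul]
  simp [S150, eca1]

lemma support_poly1 (c : ZMod 2) :
    ∀ g ∈ (poly1 c).coeff.support, ∀ i : Unit, |(fun _ => AddMonoidHom.id ℤ) i g| ≤ 1 := by
  intro g hg i
  rw [Finsupp.mem_support_iff, coeff_poly1] at hg
  simp only [AddMonoidHom.id_apply]
  rw [abs_le]
  split_ifs at hg with h1 h2
  · omega
  · omega
  · exact absurd rfl hg

lemma poly1_dilate_even (c : ZMod 2) (f : AddMonoidAlgebra (ZMod 2) ℤ) (i : ℤ) :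
    (poly1 c * dilate 1 f).coeff (2 * i) = c * f.coeff i := by
  rw [coeff_poly1_mul, dilate_even, dilate_odd, show 2 * i - 1 = 2 * (i - 1) + 1 by ring,
    dilate_odd]
  ring

/-- A dilated configuration vanishes at the odd sites, so after one step an odd site holds the sum
of two neighbouring states of the original configuration. -/
lemma poly1_dilate_odd (c : ZMod 2) (f : AddMonoidAlgebra (ZMod 2) ℤ) (i : ℤ) :
    (poly1 c * dilate 1 f).coeff (2 * i + 1) = f.coeff i + f.coeff (i + 1) := by
  rw [coeff_poly1_mul, dilate_odd, add_sub_cancel_right, dilate_even,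
    show 2 * i + 1 + 1 = 2 * (i + 1) by ring, dilate_even]
  ring

/-- The number of sites at which a configuration on `ℤ` differs from its right neighbour. -/
noncomputable def jumps (u : Config ℤ) : ℕ∞ := sites fun i => u i + u (i + 1)

lemma sites_poly1_dilate (c : ZMod 2) (f : AddMonoidAlgebra (ZMod 2) ℤ) :
    sites (poly1 c * dilate 1 f).coeff = sites (fun i => c * f.coeff i) + jumps f.coeff := by
  rw [sites_eq_add_of_parity]
  simp only [poly1_dilate_even, poly1_dilate_odd]
  rfl

lemma jumps_poly1_dilate (c : ZMod 2) (f : AddMonoidAlgebra (ZMod 2) ℤ) :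
    jumps (poly1 c * dilate 1 f).coeff =
      sites (fun i => c * f.coeff i + (f.coeff i + f.coeff (i + 1))) +
      sites (fun i => f.coeff i + f.coeff (i + 1) + c * f.coeff (i + 1)) := by
  rw [jumps, sites_eq_add_of_parity]
  have h : ∀ i : ℤ, 2 * i + 1 + 1 = 2 * (i + 1) := fun i => by ring
  simp only [h, poly1_dilate_even, poly1_dilate_odd]

lemma replicatingCount_S90 : ReplicatingCount (num S90) 2 0 := by
  refine replicatingCount_of_coeff int_coord (support_poly1 0) S90_coeff ?_ ?_
  · have h : (poly1 0).coeff.support = {1, -1} := by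
      ext i
      rw [Finsupp.mem_support_iff, coeff_poly1]
      simp only [Finset.mem_insert, Finset.mem_singleton]
      split_ifs with h1 h2 <;> simp <;> omega
    rw [supportCard, h]
    rfl
  · intro f g hg
    have hg' : g = poly1 0 * dilate 1 f := by
      rw [S90_coeff] at hg
      exact AddMonoidAlgebra.ext (DFunLike.coe_injective hg)
    rw [S90_coeff, sites_poly1_dilate, hg', jumps_poly1_dilate, sites_poly1_dilate]
    simp only [zero_mul, zero_add, add_zero, sites_zero, Nat.cast_zero, Nat.cast_ofNat]
    rw [two_mul]
    rfl

lemma replicatingCount_S150 : ReplicatingCount (num S150) 1 2 := by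
  refine replicatingCount_of_coeff int_coord (support_poly1 1) S150_coeff ?_ ?_
  · have h : (poly1 1).coeff.support = {0, 1, -1} := by
      ext i
      rw [Finsupp.mem_support_iff, coeff_poly1]
      simp only [Finset.mem_insert, Finset.mem_singleton]
      split_ifs with h1 h2 <;> simp <;> omega
    rw [supportCard, h]
    rfl
  · intro f g hg
    have hg' : g = poly1 1 * dilate 1 f := by
      rw [S150_coeff] at hg
      exact AddMonoidAlgebra.ext (DFunLike.coe_injective hg)
    rw [S150_coeff, sites_poly1_dilate, hg', jumps_poly1_dilate]
    simp only [one_mul, zmod_two_cancel, zmod_two_cancel', sites_comp_add, Nat.cast_one,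
      Nat.cast_ofNat]
    rw [two_mul]

/-! ### The automata on `ℤ × ℤ` -/

/-- The two coordinates on `ℤ × ℤ`. -/
def coord2 (i : Bool) : ℤ × ℤ →+ ℤ :=
  if i then AddMonoidHom.fst ℤ ℤ else AddMonoidHom.snd ℤ ℤ

lemma coord2_eq_zero (g : ℤ × ℤ) (h : ∀ i, coord2 i g = 0) : g = 0 :=
  Prod.ext (h true) (h false)

lemma dilate_even_even (f : AddMonoidAlgebra (ZMod 2) (ℤ × ℤ)) (i j : ℤ) :
    (dilate 1 f).coeff (2 * i, 2 * j) = f.coeff (i, j) := by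
  simpa using coeff_dilate coord2_eq_zero f 1 (i, j)

lemma dilate_odd_fst (f : AddMonoidAlgebra (ZMod 2) (ℤ × ℤ)) (i j : ℤ) :
    (dilate 1 f).coeff (2 * i + 1, j) = 0 :=
  coeff_dilate_of_not f 1 fun p h => by
    have := congrArg Prod.fst h
    simp at this
    omega

lemma dilate_odd_snd (f : AddMonoidAlgebra (ZMod 2) (ℤ × ℤ)) (i j : ℤ) :
    (dilate 1 f).coeff (i, 2 * j + 1) = 0 :=
  coeff_dilate_of_not f 1 fun p h => by
    have := congrArg Prod.snd h
    simp at this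
    omega

/-- Multiplication by `c + x + x⁻¹ + y + y⁻¹` on Laurent polynomials is the rule `T₀` for `c = 0`
and the rule `T₅₂₈` for `c = 1`. -/
noncomputable def poly2 (c : ZMod 2) : AddMonoidAlgebra (ZMod 2) (ℤ × ℤ) :=
  AddMonoidAlgebra.single (0, -1) 1 + AddMonoidAlgebra.single (1, 0) 1 +
    AddMonoidAlgebra.single (0, 0) c + AddMonoidAlgebra.single (-1, 0) 1 +
    AddMonoidAlgebra.single (0, 1) 1

lemma coeff_poly2_mul (c : ZMod 2) (f : AddMonoidAlgebra (ZMod 2) (ℤ × ℤ)) (i j : ℤ) :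
    (poly2 c * f).coeff (i, j) = f.coeff (i, j + 1) + f.coeff (i - 1, j) + c * f.coeff (i, j) +
      f.coeff (i + 1, j) + f.coeff (i, j - 1) := by
  simp only [poly2, add_mul, AddMonoidAlgebra.coeff_add, Finsupp.add_apply,
    AddMonoidAlgebra.coeff_single_mul_apply, one_mul, Prod.neg_mk, Prod.mk_add_mk, neg_neg,
    neg_zero, zero_add, neg_add_eq_sub]
  rw [add_comm 1 i, add_comm 1 j]

lemma coeff_poly2 (c : ZMod 2) (g : ℤ × ℤ) :
    (poly2 c).coeff g = if g = (0, 0) then c else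
      if g = (0, -1) ∨ g = (1, 0) ∨ g = (-1, 0) ∨ g = (0, 1) then 1 else 0 := by
  obtain ⟨i, j⟩ := g
  simp only [poly2, AddMonoidAlgebra.coeff_add, Finsupp.add_apply,
    AddMonoidAlgebra.coeff_single, Finsupp.single_apply, Prod.mk.injEq]
  split_ifs <;> first | omega | simp

lemma T0_coeff (f : AddMonoidAlgebra (ZMod 2) (ℤ × ℤ)) : T0 f.coeff = (poly2 0 * f).coeff := by
  funext ⟨i, j⟩
  rw [coeff_poly2_mul]
  simp [T0, eca2]

lemma T528_coeff (f : AddMonoidAlgebra (ZMod 2) (ℤ × ℤ)) :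
    T528 f.coeff = (poly2 1 * f).coeff := by
  funext ⟨i, j⟩
  rw [coeff_poly2_mul]
  simp [T528, eca2]

lemma support_poly2 (c : ZMod 2) :
    ∀ g ∈ (poly2 c).coeff.support, ∀ i, |coord2 i g| ≤ 1 := by
  rintro ⟨i, j⟩ hg k
  rw [Finsupp.mem_support_iff, coeff_poly2] at hg
  simp only [Prod.mk.injEq] at hg
  have h : |i| ≤ 1 ∧ |j| ≤ 1 := by
    rw [abs_le, abs_le]
    split_ifs at hg with h1 h2
    · omega
    · omega
    · exact absurd rfl hg
  cases k
  · exact h.2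
  · exact h.1

lemma poly2_dilate_even_even (c : ZMod 2) (f : AddMonoidAlgebra (ZMod 2) (ℤ × ℤ)) (i j : ℤ) :
    (poly2 c * dilate 1 f).coeff (2 * i, 2 * j) = c * f.coeff (i, j) := by
  rw [coeff_poly2_mul, dilate_even_even, dilate_odd_fst, dilate_odd_snd,
    show 2 * i - 1 = 2 * (i - 1) + 1 by ring, show 2 * j - 1 = 2 * (j - 1) + 1 by ring,
    dilate_odd_fst, dilate_odd_snd]
  ring

lemma poly2_dilate_odd_even (c : ZMod 2) (f : AddMonoidAlgebra (ZMod 2) (ℤ × ℤ)) (i j : ℤ) :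
    (poly2 c * dilate 1 f).coeff (2 * i + 1, 2 * j) = f.coeff (i, j) + f.coeff (i + 1, j) := by
  rw [coeff_poly2_mul, dilate_odd_fst, dilate_odd_fst, dilate_odd_fst, add_sub_cancel_right,
    dilate_even_even, show 2 * i + 1 + 1 = 2 * (i + 1) by ring, dilate_even_even]
  ring

lemma poly2_dilate_even_odd (c : ZMod 2) (f : AddMonoidAlgebra (ZMod 2) (ℤ × ℤ)) (i j : ℤ) :
    (poly2 c * dilate 1 f).coeff (2 * i, 2 * j + 1) = f.coeff (i, j) + f.coeff (i, j + 1) := by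
  rw [coeff_poly2_mul, dilate_odd_snd, dilate_odd_snd, dilate_odd_snd, add_sub_cancel_right,
    dilate_even_even, show 2 * j + 1 + 1 = 2 * (j + 1) by ring, dilate_even_even]
  ring

lemma poly2_dilate_odd_odd (c : ZMod 2) (f : AddMonoidAlgebra (ZMod 2) (ℤ × ℤ)) (i j : ℤ) :
    (poly2 c * dilate 1 f).coeff (2 * i + 1, 2 * j + 1) = 0 := by
  rw [coeff_poly2_mul, dilate_odd_fst, dilate_odd_snd, dilate_odd_snd, dilate_odd_snd,
    dilate_odd_fst]
  ring

/-- The number of sites at which a configuration differs from its right neighbour. -/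
noncomputable def jumpsFst (u : Config (ℤ × ℤ)) : ℕ∞ :=
  sites fun p : ℤ × ℤ => u (p.1, p.2) + u (p.1 + 1, p.2)

/-- The number of sites at which a configuration differs from its upper neighbour. -/
noncomputable def jumpsSnd (u : Config (ℤ × ℤ)) : ℕ∞ :=
  sites fun p : ℤ × ℤ => u (p.1, p.2) + u (p.1, p.2 + 1)

lemma sites_poly2_dilate (c : ZMod 2) (f : AddMonoidAlgebra (ZMod 2) (ℤ × ℤ)) :
    sites (poly2 c * dilate 1 f).coeff =
      sites (fun p : ℤ × ℤ => c * f.coeff p) + jumpsFst f.coeff + jumpsSnd f.coeff := by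
  rw [sites_eq_add_of_parities]
  simp only [poly2_dilate_even_even, poly2_dilate_even_odd, poly2_dilate_odd_even,
    poly2_dilate_odd_odd, sites_zero, Prod.mk.eta, add_zero]
  exact add_right_comm _ _ _

lemma jumpsFst_poly2_dilate (c : ZMod 2) (f : AddMonoidAlgebra (ZMod 2) (ℤ × ℤ)) :
    jumpsFst (poly2 c * dilate 1 f).coeff =
      sites (fun p : ℤ × ℤ => c * f.coeff (p.1, p.2) +
        (f.coeff (p.1, p.2) + f.coeff (p.1 + 1, p.2))) +
      sites (fun p : ℤ × ℤ => f.coeff (p.1, p.2) + f.coeff (p.1 + 1, p.2) +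
        c * f.coeff (p.1 + 1, p.2)) + 2 * jumpsSnd f.coeff := by
  have h : ∀ i : ℤ, 2 * i + 1 + 1 = 2 * (i + 1) := fun i => by ring
  have e : sites (fun p : ℤ × ℤ => f.coeff (p.1 + 1, p.2) + f.coeff (p.1 + 1, p.2 + 1)) =
      jumpsSnd f.coeff :=
    sites_comp_right fun p : ℤ × ℤ => f.coeff (p.1, p.2) + f.coeff (p.1, p.2 + 1)
  rw [jumpsFst, sites_eq_add_of_parities]
  simp only [h, poly2_dilate_even_even, poly2_dilate_even_odd, poly2_dilate_odd_even,
    poly2_dilate_odd_odd, add_zero, zero_add]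
  rw [e, ← jumpsSnd.eq_def (f.coeff : ℤ × ℤ → ZMod 2)]
  ring

lemma jumpsSnd_poly2_dilate (c : ZMod 2) (f : AddMonoidAlgebra (ZMod 2) (ℤ × ℤ)) :
    jumpsSnd (poly2 c * dilate 1 f).coeff =
      sites (fun p : ℤ × ℤ => c * f.coeff (p.1, p.2) +
        (f.coeff (p.1, p.2) + f.coeff (p.1, p.2 + 1))) +
      sites (fun p : ℤ × ℤ => f.coeff (p.1, p.2) + f.coeff (p.1, p.2 + 1) +
        c * f.coeff (p.1, p.2 + 1)) + 2 * jumpsFst f.coeff := by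
  have h : ∀ i : ℤ, 2 * i + 1 + 1 = 2 * (i + 1) := fun i => by ring
  have e : sites (fun p : ℤ × ℤ => f.coeff (p.1, p.2 + 1) + f.coeff (p.1 + 1, p.2 + 1)) =
      jumpsFst f.coeff :=
    sites_comp_up fun p : ℤ × ℤ => f.coeff (p.1, p.2) + f.coeff (p.1 + 1, p.2)
  rw [jumpsSnd, sites_eq_add_of_parities]
  simp only [h, poly2_dilate_even_even, poly2_dilate_even_odd, poly2_dilate_odd_even,
    poly2_dilate_odd_odd, add_zero, zero_add]
  rw [e, ← jumpsFst.eq_def (f.coeff : ℤ × ℤ → ZMod 2)]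
  ring

lemma replicatingCount_T0 : ReplicatingCount (num T0) 4 0 := by
  refine replicatingCount_of_coeff coord2_eq_zero (support_poly2 0) T0_coeff ?_ ?_
  · have h : (poly2 0).coeff.support = {(0, -1), (1, 0), (-1, 0), (0, 1)} := by
      ext g
      rw [Finsupp.mem_support_iff, coeff_poly2]
      simp only [Finset.mem_insert, Finset.mem_singleton]
      split_ifs with h1 h2
      · simp [h1]
      · simp [h2]
      · simp [h2]
    rw [supportCard, h]
    rfl
  · intro f g hg
    have hg' : g = poly2 0 * dilate 1 f := by
      rw [T0_coeff] at hg
      exact AddMonoidAlgebra.ext (DFunLike.coe_injective hg)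
    rw [T0_coeff, sites_poly2_dilate, hg', jumpsFst_poly2_dilate, jumpsSnd_poly2_dilate,
      sites_poly2_dilate]
    simp only [zero_mul, zero_add, add_zero, sites_zero, Nat.cast_zero, Nat.cast_ofNat]
    rw [← jumpsFst.eq_def (f.coeff : ℤ × ℤ → ZMod 2), ← jumpsSnd.eq_def (f.coeff : ℤ × ℤ → ZMod 2)]
    ring

lemma replicatingCount_T528 : ReplicatingCount (num T528) 3 2 := by
  refine replicatingCount_of_coeff coord2_eq_zero (support_poly2 1) T528_coeff ?_ ?_
  · have h : (poly2 1).coeff.support = {(0, 0), (0, -1), (1, 0), (-1, 0), (0, 1)} := by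
      ext g
      rw [Finsupp.mem_support_iff, coeff_poly2]
      simp only [Finset.mem_insert, Finset.mem_singleton]
      split_ifs with h1 h2
      · simp [h1]
      · simp [h2]
      · simp [h1, h2]
    rw [supportCard, h]
    rfl
  · intro f g hg
    have hg' : g = poly2 1 * dilate 1 f := by
      rw [T528_coeff] at hg
      exact AddMonoidAlgebra.ext (DFunLike.coe_injective hg)
    rw [T528_coeff, sites_poly2_dilate, hg', jumpsFst_poly2_dilate, jumpsSnd_poly2_dilate]
    simp only [one_mul, zmod_two_cancel, zmod_two_cancel', sites_comp_right, sites_comp_up,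
      Prod.mk.eta, Nat.cast_ofNat]
    rw [sites_poly2_dilate]
    simp only [one_mul]
    ring

namespace ReplicatingCount

/-! ### The singularity conditions -/

variable {a : ℕ → ℕ} {b c : ℕ} {α : ℝ}

/-- The counts `a (2 ^ s - 1)` of a single cluster of ones obey a two-term linear recursion. -/
lemma cluster_rec (ha : ReplicatingCount a b c) (s : ℕ) :
    a (2 ^ (s + 2) - 1) = b * a (2 ^ (s + 1) - 1) + c * a (2 ^ s - 1) := by
  have h := ha.step (2 ^ s - 1)
  have := Nat.one_le_two_pow (n := s)
  have e : 2 ^ (s + 2) = 2 ^ s * 4 := pow_add 2 s 2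
  rwa [show 4 * (2 ^ s - 1) + 3 = 2 ^ (s + 2) - 1 by omega,
    show 2 * (2 ^ s - 1) + 1 = 2 ^ (s + 1) - 1 by rw [pow_succ]; omega] at h

lemma cluster_zero (ha : ReplicatingCount a b c) : a (2 ^ 0 - 1) = 1 := by simp [ha.zero]

lemma cluster_one (ha : ReplicatingCount a b c) : a (2 ^ 1 - 1) = b + c := by simp [ha.one]

lemma cluster_lt_succ (ha : ReplicatingCount a b c) (hα : AdmissibleRate b c α) (s : ℕ) :
    a (2 ^ s - 1) < a (2 ^ (s + 1) - 1) := by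
  have hb := hα.one_le_b
  have h2 := hα.two_le
  induction s with
  | zero =>
    rw [zero_add, ha.cluster_zero, ha.cluster_one]
    omega
  | succ s ih =>
    rw [show s + 1 + 1 = s + 2 from rfl, ha.cluster_rec]
    have h0 := ha.pos hα (2 ^ s - 1)
    have h1 : a (2 ^ (s + 1) - 1) ≤ b * a (2 ^ (s + 1) - 1) := Nat.le_mul_of_pos_left _ hb
    rcases Nat.eq_zero_or_pos c with rfl | hc
    · have : 2 * a (2 ^ (s + 1) - 1) ≤ b * a (2 ^ (s + 1) - 1) :=
        Nat.mul_le_mul_right _ (by omega)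
      omega
    · have : 0 < c * a (2 ^ s - 1) := Nat.mul_pos hc h0
      omega

/-- Both sides satisfy the same linear recursion in `t`, with nonnegative coefficients, so it
suffices to compare them for `t = 0` and `t = 1`. -/
lemma cluster_mul_lt (ha : ReplicatingCount a b c) (hα : AdmissibleRate b c α) (s t : ℕ) :
    a (2 ^ s - 1) * a (2 ^ t - 1) < a (2 ^ (s + t + 1) - 1) := by
  have hb := hα.one_le_b
  induction t using Nat.twoStepInduction with
  | zero => simpa [ha.zero] using ha.cluster_lt_succ hα s
  | one =>
    rw [ha.cluster_one, show s + 1 + 1 = s + 2 from rfl, ha.cluster_rec]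
    have := Nat.mul_lt_mul_of_pos_left (ha.cluster_lt_succ hα s) hb
    nlinarith
  | more t h0 h1 =>
    rw [show s + (t + 2) + 1 = s + t + 1 + 2 by ring, ha.cluster_rec, ha.cluster_rec]
    have e1 := Nat.mul_lt_mul_of_pos_left h1 hb
    have e0 := Nat.mul_le_mul_left c h0.le
    rw [show s + (t + 1) + 1 = s + t + 1 + 1 by ring] at e1
    calc a (2 ^ s - 1) * (b * a (2 ^ (t + 1) - 1) + c * a (2 ^ t - 1))
        = b * (a (2 ^ s - 1) * a (2 ^ (t + 1) - 1)) + c * (a (2 ^ s - 1) * a (2 ^ t - 1)) := by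
          ring
      _ < _ := by omega

lemma cluster_add_le (ha : ReplicatingCount a b c) (s t : ℕ) :
    a (2 ^ (s + t) - 1) ≤ a (2 ^ s - 1) * a (2 ^ t - 1) := by
  have h := ha.submul (2 ^ t * (2 ^ s - 1)) (2 ^ t - 1)
  rw [ha.two_pow_mul] at h
  refine le_trans (le_of_eq (congrArg a ?_)) h
  have h1 := Nat.one_le_two_pow (n := t)
  have h2 : 2 ^ t ≤ 2 ^ t * 2 ^ s := Nat.le_mul_of_pos_right _ (by positivity)
  rw [Nat.mul_sub, mul_one, pow_add, mul_comm]
  omega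

lemma cluster_succ_mul_le (ha : ReplicatingCount a b c) (hα : AdmissibleRate b c α) {s : ℕ}
    (hs : 0 < s) : b * a (2 ^ (s + 1) - 1) ≤ (b ^ 2 + c) * a (2 ^ s - 1) := by
  have hb := hα.one_le_b
  obtain ⟨r, rfl⟩ : ∃ r, s = r + 1 := ⟨s - 1, by omega⟩
  have h : b * a (2 ^ r - 1) ≤ a (2 ^ (r + 1) - 1) := by
    cases r with
    | zero =>
      rw [zero_add, ha.cluster_zero, ha.cluster_one]
      omega
    | succ r =>
      rw [show r + 1 + 1 = r + 2 from rfl, ha.cluster_rec]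
      omega
  rw [show r + 1 + 1 = r + 2 from rfl, ha.cluster_rec]
  have := Nat.mul_le_mul_left c h
  calc b * (b * a (2 ^ (r + 1) - 1) + c * a (2 ^ r - 1))
      = b ^ 2 * a (2 ^ (r + 1) - 1) + c * (b * a (2 ^ r - 1)) := by ring
    _ ≤ _ := by linarith

/-- The series telescopes: its tails are `α ^ n (x q(n) + y q(n + 1))` for the two numbers `x`,
`y` determined by the recursion of `q` and by the equation for `α`. -/
lemma hasSum_cluster (ha : ReplicatingCount a b c) (hα : AdmissibleRate b c α) :
    HasSum (fun j : ℕ => (a (2 ^ j - 1) : ℝ) * α ^ (j + 1)) 1 := by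
  have hpos := hα.alpha_pos
  have hchar := hα.char_eq
  have hD : 0 < 1 + c * α := by positivity
  set y := α / (1 + c * α) with hy
  have hyD : y * (1 + c * α) = α := div_mul_cancel₀ _ hD.ne'
  set x := y * (1 + 2 * c * α) with hx
  have hR : ∀ n, ∑ j ∈ Finset.range n, (a (2 ^ j - 1) : ℝ) * α ^ (j + 1) =
      1 - α ^ n * (x * a (2 ^ n - 1) + y * a (2 ^ (n + 1) - 1)) := by
    intro n
    induction n with
    | zero =>
      rw [zero_add, ha.cluster_zero, ha.cluster_one, hx]
      push_cast
      rw [Finset.sum_range_zero]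
      have : y * (1 + 2 * c * α) + y * (b + c) = 1 := by
        rw [hy]
        field_simp
        linear_combination hchar
      linear_combination this
    | succ n ih =>
      have h : (a (2 ^ (n + 1 + 1) - 1) : ℝ) =
          b * a (2 ^ (n + 1) - 1) + c * a (2 ^ n - 1) := by exact_mod_cast ha.cluster_rec n
      rw [Finset.sum_range_succ, ih, h, pow_succ α, hx]
      linear_combination (-α ^ n * a (2 ^ n - 1)) * hyD +
        (α ^ n * y * a (2 ^ (n + 1) - 1)) * hchar
  rw [hasSum_iff_tendsto_nat_of_nonneg fun j => by positivity]
  have hbd : ∀ n, (a (2 ^ n - 1) : ℝ) ≤ b * growth b c ^ n := fun n =>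
    ha.le_growth_pow hα n _ (Nat.sub_lt (by positivity) one_pos)
  have hgeo := tendsto_pow_atTop_nhds_zero_of_lt_one hα.growth_mul_alpha_nonneg
    hα.growth_mul_alpha_lt_one
  have hy0 : 0 < y := by positivity
  have hx0 : 0 < x := by positivity
  have hz : Tendsto (fun n => α ^ n * (x * a (2 ^ n - 1) + y * a (2 ^ (n + 1) - 1))) atTop
      (𝓝 0) := by
    refine squeeze_zero (fun n => by positivity) (fun n => ?_)
      (g := fun n => (x * b + y * (b * growth b c)) * (growth b c * α) ^ n) ?_
    · calc α ^ n * (x * a (2 ^ n - 1) + y * a (2 ^ (n + 1) - 1))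
          ≤ α ^ n * (x * (b * growth b c ^ n) + y * (b * growth b c ^ (n + 1))) := by
            gcongr
            · exact hbd n
            · exact hbd (n + 1)
        _ = _ := by
            rw [mul_pow]
            ring
    · simpa using hgeo.const_mul (x * b + y * (b * growth b c))
  have := hz.const_sub 1
  rw [sub_zero] at this
  exact this.congr fun n => (hR n).symm

lemma singularityConditions (ha : ReplicatingCount a b c) (hα : AdmissibleRate b c α) :
    SingularityConditions α fun s => a (2 ^ s - 1) where
  alpha_pos := hα.alpha_pos
  alpha_lt_half := hα.alpha_lt_half
  q_pos s := ha.pos hα _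
  cond_a := ha.cluster_zero
  cond_b s₁ s₂ _ h₂ := by
    refine ⟨?_, ha.cluster_add_le s₁ s₂⟩
    have := ha.cluster_mul_lt hα s₁ (s₂ - 1)
    rwa [show s₁ + (s₂ - 1) + 1 = s₁ + s₂ by omega] at this
  cond_c s hs := by
    have hpos := hα.alpha_pos
    constructor
    · have h1 : (b * a (2 ^ (s + 1) - 1) : ℝ) ≤ (b ^ 2 + c) * a (2 ^ s - 1) := by
        exact_mod_cast ha.cluster_succ_mul_le hα hs
      have hq : (0 : ℝ) < a (2 ^ s - 1) := by exact_mod_cast ha.pos hα _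
      have h2 : (b : ℝ) * (a (2 ^ (s + 1) - 1) * α) < b * a (2 ^ s - 1) :=
        calc (b : ℝ) * (a (2 ^ (s + 1) - 1) * α) = b * a (2 ^ (s + 1) - 1) * α := by ring
          _ ≤ (b ^ 2 + c) * a (2 ^ s - 1) * α := by gcongr
          _ = ((b ^ 2 + c) * α) * a (2 ^ s - 1) := by ring
          _ < b * a (2 ^ s - 1) := by
            gcongr
            exact hα.slope
      have h3 := lt_of_mul_lt_mul_left h2 hα.b_pos.le
      calc (a (2 ^ (s + 1) - 1) : ℝ) * α ^ (s + 2)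
          = a (2 ^ (s + 1) - 1) * α * α ^ (s + 1) := by ring
        _ < _ := by gcongr
    · have hsum := ha.hasSum_cluster hα
      have hl := hsum.mul_left (a (2 ^ s - 1) * α ^ (s + 1) : ℝ)
      rw [mul_one] at hl
      have htail : Summable fun j : ℕ => (a (2 ^ (s + 1 + j) - 1) : ℝ) * α ^ (s + 2 + j) := by
        refine ((summable_nat_add_iff (s + 1)).2 hsum.summable).congr fun j => ?_
        rw [show j + (s + 1) = s + 1 + j by ring, show s + 1 + j + 1 = s + 2 + j by ring]
      have hterm : ∀ j : ℕ, (a (2 ^ s - 1) * α ^ (s + 1) : ℝ) * (a (2 ^ j - 1) * α ^ (j + 1)) <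
          (a (2 ^ (s + 1 + j) - 1) : ℝ) * α ^ (s + 2 + j) := by
        intro j
        have h : (a (2 ^ s - 1) * a (2 ^ j - 1) : ℝ) < a (2 ^ (s + 1 + j) - 1) := by
          have := ha.cluster_mul_lt hα s j
          rw [show s + j + 1 = s + 1 + j by ring] at this
          exact_mod_cast this
        calc (a (2 ^ s - 1) * α ^ (s + 1) : ℝ) * (a (2 ^ j - 1) * α ^ (j + 1))
            = (a (2 ^ s - 1) * a (2 ^ j - 1)) * α ^ (s + 2 + j) := by ring
          _ < _ := by gcongr
      exact hasSum_lt (fun j => (hterm j).le) (hterm 0) hl htail.hasSum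
  cond_d := ha.hasSum_cluster hα

variable {ι : Type} [DecidableEq ι] [Zero ι] {T : Config ι → Config ι}

/-- All conclusions for an automaton, given a closed form `w` of the counts of single clusters. -/
lemma conclusions (ha : ReplicatingCount (num T) b c) (hα : AdmissibleRate b c α)
    {w : ℕ → ℝ} (h0 : w 0 = 1) (h1 : w 1 = b + c)
    (hw : ∀ s, w (s + 2) = b * w (s + 1) + c * w s) :
    IsWellDefined T ∧ SatisfiesSingularityHypotheses (normalizedCount T) α w ∧
      IsSingularFunction (normalizedCount T) := by
  refine ⟨ha.isWellDefined hα, ⟨fun s => num T (2 ^ s - 1), fun s => ?_,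
    ha.singularityConditions hα, ha.hasSum_normalizedCount hα⟩, ha.isSingularFunction hα⟩
  induction s using Nat.twoStepInduction with
  | zero => simp [ha.zero, h0]
  | one => simp [ha.one, h1]
  | more s e0 e1 =>
    rw [hw, ← e0, ← e1]
    exact_mod_cast ha.cluster_rec s

end ReplicatingCount

/-! ### The four growth rates -/

lemma admissibleRate_S90 : AdmissibleRate 2 0 (1 / 3) := by
  constructor <;> norm_num

lemma admissibleRate_T0 : AdmissibleRate 4 0 (1 / 5) := by
  constructor <;> norm_num

lemma admissibleRate_S150 : AdmissibleRate 1 2 ((Real.sqrt 5 - 1) / 4) := by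
  have h := Real.sq_sqrt (show (0 : ℝ) ≤ 5 by norm_num)
  have h1 : 2 < Real.sqrt 5 := Real.lt_sqrt_of_sq_lt (by norm_num)
  have h2 : Real.sqrt 5 < 7 / 3 := (Real.sqrt_lt' (by norm_num)).2 (by norm_num)
  constructor
  · linarith
  · linarith
  · norm_num
  · norm_num
  · push_cast
    linear_combination h / 4
  · push_cast
    linarith

lemma admissibleRate_T528 : AdmissibleRate 3 2 ((Real.sqrt 2 - 1) / 2) := by
  have h := Real.sq_sqrt (show (0 : ℝ) ≤ 2 by norm_num)
  have h1 : 1 < Real.sqrt 2 := Real.lt_sqrt_of_sq_lt (by norm_num)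
  have h2 : Real.sqrt 2 < 3 / 2 := (Real.sqrt_lt' (by norm_num)).2 (by norm_num)
  constructor
  · linarith
  · linarith
  · norm_num
  · norm_num
  · push_cast
    linear_combination h
  · push_cast
    linarith

end CountingCA

theorem mainTheorem2 :
    (CountingCA.IsWellDefined CountingCA.S90 ∧
      CountingCA.SatisfiesSingularityHypotheses (CountingCA.normalizedCount CountingCA.S90)
        (1 / 3) (fun s => 2 ^ s) ∧
      CountingCA.IsSingularFunction (CountingCA.normalizedCount CountingCA.S90)) ∧
    (CountingCA.IsWellDefined CountingCA.S150 ∧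
      CountingCA.SatisfiesSingularityHypotheses (CountingCA.normalizedCount CountingCA.S150)
        ((Real.sqrt 5 - 1) / 4) (fun s => ((-1) ^ (s + 1) + 2 ^ (s + 2)) / 3) ∧
      CountingCA.IsSingularFunction (CountingCA.normalizedCount CountingCA.S150)) ∧
    (CountingCA.IsWellDefined CountingCA.T0 ∧
      CountingCA.SatisfiesSingularityHypotheses (CountingCA.normalizedCount CountingCA.T0)
        (1 / 5) (fun s => 4 ^ s) ∧
      CountingCA.IsSingularFunction (CountingCA.normalizedCount CountingCA.T0)) ∧
    (CountingCA.IsWellDefined CountingCA.T528 ∧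
      CountingCA.SatisfiesSingularityHypotheses (CountingCA.normalizedCount CountingCA.T528)
        ((Real.sqrt 2 - 1) / 2)
        (fun s =>
          (17 + 7 * Real.sqrt 17) / 34 * ((3 + Real.sqrt 17) / 2) ^ s +
            (17 - 7 * Real.sqrt 17) / 34 * ((3 - Real.sqrt 17) / 2) ^ s) ∧
      CountingCA.IsSingularFunction (CountingCA.normalizedCount CountingCA.T528)) := by
  refine ⟨CountingCA.replicatingCount_S90.conclusions CountingCA.admissibleRate_S90 ?_ ?_ ?_,
    CountingCA.replicatingCount_S150.conclusions CountingCA.admissibleRate_S150 ?_ ?_ ?_,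
    CountingCA.replicatingCount_T0.conclusions CountingCA.admissibleRate_T0 ?_ ?_ ?_,
    CountingCA.replicatingCount_T528.conclusions CountingCA.admissibleRate_T528 ?_ ?_ ?_⟩
  · norm_num
  · norm_num
  · intro s
    push_cast
    ring
  · norm_num
  · norm_num
  · intro s
    push_cast
    ring
  · norm_num
  · norm_num
  · intro s
    push_cast
    ring
  · ring
  · have h := Real.sq_sqrt (show (0 : ℝ) ≤ 17 by norm_num)
    push_cast
    linear_combination (7 / 34) * h
  · intro s
    -- Each summand solves the recursion, as `(3 ± √17) / 2` are the roots of `X ^ 2 = 3 X + 2`.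
    have h := Real.sq_sqrt (show (0 : ℝ) ≤ 17 by norm_num)
    push_cast
    linear_combination ((17 + 7 * Real.sqrt 17) / 34 * ((3 + Real.sqrt 17) / 2) ^ s / 4 +
      (17 - 7 * Real.sqrt 17) / 34 * ((3 - Real.sqrt 17) / 2) ^ s / 4) * h
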